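/- Let $F=\mathbb F_q$ be a finite field, $n\ge 0$ an integer, and $U=U_n(q)$ the group of upper triangular $n\times n$ matrices over $F$ with ones on the diagonal. For $1\le i\le j<n$ let $\alpha_{i,j}=\alpha_i+\dots+\alpha_j$ denote the corresponding positive root of type $A_{n-1}$, and let $X_{\alpha_{i,j}}=\{I_n+c\,e_{i,j+1}:c\in F\}$ be its root subgroup. Put $\mathrm{arm}(\alpha_{i,j})=\{\alpha_{i,l}:i\le l<j\}$, $\mathrm{leg}(\alpha_{i,j})=\{\alpha_{k,j}:i<k\le j\}$ and $h(\alpha)=\{\alpha\}\cup\mathrm{arm}(\alpha)\cup\mathrm{leg}(\alpha)$. Let $H(\alpha)=\langle X_\beta:\beta\in h(\alpha)\rangle$ be the hook group, $V_\alpha=\langle X_\beta:\beta\notin\mathrm{arm}(\alpha)\rangle$ the base group, and $U_{\alpha_{i,j}}=\langle X_{\alpha_{s,t}}:i\le s\le t\le j\rangle$ the subtriangular group (trivial when $j<i$). Let $\Lambda_\alpha$ be the set of linear characters $\lambda:V_\alpha\to\mathbb C^\times$ which are nontrivial on $X_\alpha$ and trivial on all other root subgroups contained in $V_\alpha$. For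 $\lambda\in\Lambda_\alpha$ the induced character $\lambda^U$ is called an elementary character at $\alpha$. Let $\lambda_1\in\Lambda_{\alpha_{i,j}}$ and $\lambda_2\in\Lambda_{\alpha_{l,k}}$ be such that the elementary characters $\lambda_1^U,\lambda_2^U$ are nonlinear (not of degree $1$). Then, up to interchanging the two characters, one of the following five cases applies, and in each case $\lambda_1^U\otimes\lambda_2^U$ decomposes as stated. (i) If $|H(\alpha_{i,j})\cap H(\alpha_{l,k})|=1$, then $\lambda_1^U\otimes\lambda_2^U$ is irreducible. (ii) If $|H(\alpha_{i,j})\cap H(\alpha_{l,k})|=q$, then $\lambda_1^U\otimes\lambda_2^U$ is the sum of $q$ pairwise distinct irreducible characters, each of degree $q^{(j-i)+(k-l)-1}$ and each occurring with multiplicity $1$. (iii) If $\alpha_{i,j}\in\mathrm{leg}(\alpha_{l,k})$ (respectively $\alpha_{i,j}\in\mathrm{arm}(\alpha_{l,k})$), then $$\lambda_1^U\otimes\lambda_2^U=\lambda_2^U+\sum_{\alpha}\sum_{\lambda\in\Lambda_\alpha}\lambda_2^U\otimes\lambda^U,$$ where $\alpha$ runs over $\mathrm{arm}(\alpha_{i,j})$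 (respectively $\mathrm{leg}(\alpha_{i,j})$); the characters $\lambda_2^U$ and $\lambda_2^U\otimes\lambda^U$ on the right are irreducible and pairwise distinct, so each has multiplicity $1$. (iv) If $\alpha_{i,j}=\alpha_{l,k}$ and $\lambda_1^U\ne\overline{\lambda_2^U}$, then $$\lambda_1^U\otimes\lambda_2^U=\bigl(q+(j-i-1)(q-1)\bigr)(\lambda_1\otimes\lambda_2)^U+(q-1)\sum_{\alpha}\sum_{\lambda\in\Lambda_\alpha}(\lambda_1\otimes\lambda_2)^U\otimes\lambda^U,$$ where $\alpha$ runs over the positive roots with $U_\alpha\subseteq U_{\alpha_{i+1,j-1}}$; the characters $(\lambda_1\otimes\lambda_2)^U$ and $(\lambda_1\otimes\lambda_2)^U\otimes\lambda^U$ on the right are irreducible and pairwise distinct, so the first has multiplicity $q+(j-i-1)(q-1)$ and each of the others has multiplicity $q-1$. (v) If $\alpha_{i,j}=\alpha_{l,k}$ and $\lambda_1^U=\overline{\lambda_2^U}$, then $$\lambda_1^U\otimes\lambda_2^U=1_U+\sum_{\beta_1,\mu_1}\mu_1^U+\sum_{\beta_2,\mu_2}\mu_2^U+\sum_{\beta_1,\mu_1}\sum_{\beta_2,\mu_2}\mu_1^U\otimes\mu_2^U,$$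 where $\beta_1$ runs over $\mathrm{arm}(\alpha_{i,j})$, $\mu_1$ over $\Lambda_{\beta_1}$, $\beta_2$ over $\mathrm{leg}(\alpha_{i,j})$ and $\mu_2$ over $\Lambda_{\beta_2}$. -/

import Mathlib

noncomputable section

namespace UTri

/-! ### Irreducible and induced characters of finite groups (over `ℂ`) -/

section Characters

variable {G : Type*} [Group G]

/-- `χ ∈ Irr(G)`: `χ` is the character of an irreducible finite-dimensional complex representation
of `G`. -/
def IsIrr (χ : G → ℂ) : Prop :=
  ∃ (d : ℕ) (ρ : Representation ℂ G (Fin d → ℂ)), ρ.IsIrreducible ∧ ρ.character = χ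

open Classical in
/-- The induced character `μ^G` of a linear character `μ` of a subgroup `H` of a finite group `G`:
`μ^G(g) = |H|⁻¹ ∑_{x ∈ G} μ°(x⁻¹ g x)`, where `μ°` is `μ` extended by zero. -/
def ind {H : Subgroup G} (μ : H →* ℂˣ) : G → ℂ := fun g =>
  (Nat.card H : ℂ)⁻¹ *
    ∑ᶠ x : G, if h : x⁻¹ * g * x ∈ H then ((μ ⟨x⁻¹ * g * x, h⟩ : ℂˣ) : ℂ) else 0

/-- `χ` decomposes into the pairwise distinct irreducible characters `φ a`, `a ∈ ι`, each with
multiplicity `m a`. -/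
def DecomposesInto {ι : Type*} [Finite ι] (χ : G → ℂ) (m : ι → ℕ) (φ : ι → G → ℂ) : Prop :=
  (∀ a, IsIrr (φ a)) ∧ Function.Injective φ ∧ χ = ∑ᶠ a, m a • φ a

end Characters

/-! ### The group `U_n(q)` -/

/-- The group of upper triangular `n × n` matrices over `F` with ones on the diagonal. -/
def U (n : ℕ) (F : Type*) [Field F] : Subgroup (GL (Fin n) F) where
  carrier := {g | (∀ a, (g : Matrix (Fin n) (Fin n) F) a a = 1) ∧
    ∀ a b, b < a → (g : Matrix (Fin n) (Fin n) F) a b = 0}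
  one_mem' := by
    refine ⟨fun a => by simp, fun a b h => by simp [h.ne']⟩
  mul_mem' := by
    rintro g h ⟨g1, g0⟩ ⟨h1, h0⟩
    refine ⟨fun a => ?_, fun a b hab => ?_⟩
    · rw [Units.val_mul, Matrix.mul_apply, Finset.sum_eq_single a, g1, h1, one_mul]
      · intro c _ hc
        rcases lt_or_gt_of_ne hc with h | h
        · rw [g0 _ _ h, zero_mul]
        · rw [h0 _ _ h, mul_zero]
      · simp
    · rw [Units.val_mul, Matrix.mul_apply]
      refine Finset.sum_eq_zero fun c _ => ?_
      rcases lt_or_ge c a with h | h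
      · rw [g0 _ _ h, zero_mul]
      · rw [h0 _ _ (hab.trans_le h), mul_zero]
  inv_mem' := by
    rintro g ⟨g1, g0⟩
    have hT : (g : Matrix (Fin n) (Fin n) F).BlockTriangular id := fun a b h => g0 a b h
    have i0 : ∀ a b, b < a → ((g⁻¹ : GL (Fin n) F) : Matrix (Fin n) (Fin n) F) a b = 0 := by
      intro a b h
      let _ : Invertible (g : Matrix (Fin n) (Fin n) F) := g.invertible
      have := Matrix.blockTriangular_inv_of_blockTriangular hT (i := a) (j := b) h
      rwa [← Matrix.coe_units_inv] at this
    refine ⟨fun a => ?_, i0⟩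
    have h : ((g * g⁻¹ : GL (Fin n) F) : Matrix (Fin n) (Fin n) F) a a = 1 := by simp
    rw [Units.val_mul, Matrix.mul_apply, Finset.sum_eq_single a, g1, one_mul] at h
    · exact h
    · intro c _ hc
      rcases lt_or_gt_of_ne hc with h' | h'
      · rw [g0 _ _ h', zero_mul]
      · rw [i0 _ _ h', mul_zero]
    · simp

/-! ### Positive roots, arms, legs, hooks -/

/-- The positive roots of type `A_{n-1}`. The root `α_{i,j} = α_i + ⋯ + α_j` (`1 ≤ i ≤ j < n`)
corresponds to the position `(i, j + 1)` above the diagonal, with rows and columns counted from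
`1`; as the elements of `Fin n` are counted from `0`, it is the pair `(i - 1, j)`. -/
abbrev PosRoot (n : ℕ) : Type := {p : Fin n × Fin n // p.1 < p.2}

namespace PosRoot

variable {n : ℕ}

/-- The row of the position of a root (counted from `0`). -/
def row (α : PosRoot n) : Fin n := α.1.1

/-- The column of the position of a root (counted from `0`). -/
def col (α : PosRoot n) : Fin n := α.1.2

/-- The index `i` of `α = α_{i,j}`. -/
def i (α : PosRoot n) : ℕ := (α.row : ℕ) + 1

/-- The index `j` of `α = α_{i,j}`. -/
def j (α : PosRoot n) : ℕ := (α.col : ℕ)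

/-- `arm(α_{i,j}) = {α_{i,l} : i ≤ l < j}`. -/
def arm (α : PosRoot n) : Finset (PosRoot n) :=
  Finset.univ.filter fun β => β.i = α.i ∧ β.j < α.j

/-- `leg(α_{i,j}) = {α_{k,j} : i < k ≤ j}`. -/
def leg (α : PosRoot n) : Finset (PosRoot n) :=
  Finset.univ.filter fun β => β.j = α.j ∧ α.i < β.i

/-- The hook `h(α) = {α} ∪ arm(α) ∪ leg(α)`. -/
def hook (α : PosRoot n) : Finset (PosRoot n) := {α} ∪ α.arm ∪ α.leg

end PosRoot

/-! ### Subgroups generated by root subgroups -/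

section Subgroups

variable {n : ℕ} (F : Type*) [Field F]

/-- The root subgroup `X_α = {1 + c • e : c ∈ F}`, `e` the matrix unit at the position of `α`. -/
def X (α : PosRoot n) : Subgroup (U n F) where
  carrier := {g | ∃ c : F,
    ((g : GL (Fin n) F) : Matrix (Fin n) (Fin n) F) = 1 + Matrix.single α.row α.col c}
  one_mem' := ⟨0, by simp⟩
  mul_mem' := by
    rintro g h ⟨c, hc⟩ ⟨d, hd⟩
    refine ⟨c + d, ?_⟩
    have := Matrix.transvection_mul_transvection_same (R := F) α.row α.col (ne_of_lt α.2) c d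
    simpa only [Subgroup.coe_mul, Units.val_mul, hc, hd, Matrix.transvection] using this
  inv_mem' := by
    rintro g ⟨c, hc⟩
    refine ⟨-c, ?_⟩
    have := Matrix.transvection_mul_transvection_same (R := F) α.row α.col (ne_of_lt α.2) c (-c)
    simp only [Matrix.transvection, add_neg_cancel, Matrix.single_zero, add_zero] at this
    rw [Subgroup.coe_inv]
    exact Units.inv_eq_of_mul_eq_one_right (by rw [hc]; exact this)

/-- `⟨X_β : β ∈ S⟩`. -/
def gen (S : Set (PosRoot n)) : Subgroup (U n F) := ⨆ β ∈ S, X F β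

/-- The hook group `H(α) = ⟨X_β : β ∈ h(α)⟩`. -/
def hookGroup (α : PosRoot n) : Subgroup (U n F) := gen F {β | β ∈ α.hook}

/-- The base group `V_α = ⟨X_β : β ∉ arm(α)⟩`. -/
def baseGroup (α : PosRoot n) : Subgroup (U n F) := gen F {β | β ∉ α.arm}

/-- The subtriangular group `U_{α_{i,j}} = ⟨X_{α_{s,t}} : i ≤ s ≤ t ≤ j⟩`, for arbitrary
`i`, `j` (trivial if `j < i`). -/
def subtri (n : ℕ) (i j : ℕ) : Subgroup (U n F) := gen F {β : PosRoot n | i ≤ β.i ∧ β.j ≤ j}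

/-- `Irr(V_α/[V_α,V_α])^*`: the linear characters of the base group `V_α` which are nontrivial on
`X_α` and trivial on every other root subgroup contained in `V_α`. -/
abbrev BaseChar (α : PosRoot n) : Type _ :=
  {μ : baseGroup F α →* ℂˣ //
    (∃ v : baseGroup F α, (v : U n F) ∈ X F α ∧ μ v ≠ 1) ∧
    ∀ β : PosRoot n, β ≠ α → X F β ≤ baseGroup F α →
      ∀ v : baseGroup F α, (v : U n F) ∈ X F β → μ v = 1}

/-- The elementary character `μ^U` at `α`, for `μ ∈ Irr(V_α/[V_α,V_α])^*`. -/
abbrev elem {F : Type*} [Field F] {α : PosRoot n} (μ : BaseChar F α) : U n F → ℂ := ind μ.1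

end Subgroups

end UTri

end

/-! Let `q = |F|` and fix a primitive additive character `ψ` of `F`. A linear character in `Λ_α` is
`v ↦ ψ (c v_α)` with `c ≠ 0`, and a right coset of the base group `V_α` is the same thing as a row
of `α` cut off before the column of `α`. Hence the elementary character at the position `(a, b)` is
`g ↦ ∑ ψ (c (x N)_b)`, where `N = g - 1` and `x` runs over the row vectors with leading entry `x_a =
1`, zero from `b` on, such that `x N` vanishes strictly between `a` and `b` (`ind_eq_chi`). A second
sum, over column vectors, turns this into a sum of `ψ (c x N y)` that is symmetric in rows and
columns (`card_pow_mul_chi`), so reflection in the antidiagonal exchanges arms and legs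
(`chi_flip`).

When the two roots share a column or coincide, the product is computed by translating row vectors.
If one root lies in the leg of the other, a translation absorbs the phase of the shorter factor,
which becomes the number of its fixed row vectors (`chi_mul_chi_same_col`); this number is `1` plus
the sum of the elementary characters along the arm (`numFix_eq`). The arm case is its reflection. If
the roots coincide, write the second vector as `x + z`. Opposite coefficients make the product split
into a count of fixed rows and a count of fixed columns (`chi_mul_chi_neg`). Otherwise the phase of
`z` can be absorbed (`chi_mul_chi_add`), and the number of the `z`, sorted by leading entry, yields
the multiplicities (`card_fixMid`).

Irreducibility and distinctness come from scalar products. Up to a power of `q`, all characters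
involved are sums of functions `g ↦ ψ (∑ M_p g_p)`; these are orthogonal, so a scalar product counts
coincidences between coefficient families `M` (`Expands.cip`). For an elementary character `M` is `c
x_r y_s`, and its row and column through `α` reveal `y` and `x`. For disjoint hooks this survives
addition of the second family (`Below.recover`), so the product has norm `1`. For crossing hooks one
parameter in `F` is lost, so the norm is at most `q` (`Crossing.cip_le`). Since the product is also
a sum of `q` characters induced from a subgroup containing `V_α ∩ V_β` with index `q`
(`Crossing.sum_ind`), these must be irreducible and distinct (`irr_of_cip_sum_le`). -/

noncomputable section

namespace UTri

/-! ### Characters of finite groups -/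

section CharacterTheory

open Representation Module

variable {G : Type*} [Group G]

/-- `χ` is the character of a finite-dimensional complex representation of `G`. -/
def IsChar (χ : G → ℂ) : Prop :=
  ∃ (d : ℕ) (ρ : Representation ℂ G (Fin d → ℂ)), ρ.character = χ

lemma exists_fin_equiv {V : Type*} [AddCommGroup V] [Module ℂ V] [FiniteDimensional ℂ V]
    (ρ : Representation ℂ G V) :
    ∃ (σ : Representation ℂ G (Fin (finrank ℂ V) → ℂ)), σ.character = ρ.character := by
  let e : V ≃ₗ[ℂ] (Fin (finrank ℂ V) → ℂ) := (finBasis ℂ V).equivFun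
  refine ⟨
    { toFun := fun g => e.conj (ρ g)
      map_one' := by ext; simp [LinearEquiv.conj_apply]
      map_mul' := fun g h => by ext; simp [LinearEquiv.conj_apply] }, ?_⟩
  ext g
  exact LinearMap.trace_conj' (ρ g) e

lemma IsChar.of_representation {V : Type*} [AddCommGroup V] [Module ℂ V] [FiniteDimensional ℂ V]
    (ρ : Representation ℂ G V) : IsChar ρ.character :=
  ⟨_, exists_fin_equiv ρ⟩

lemma IsChar.mul {χ φ : G → ℂ} (hχ : IsChar χ) (hφ : IsChar φ) : IsChar (χ * φ) := by
  obtain ⟨_, ρ, rfl⟩ := hχ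
  obtain ⟨_, σ, rfl⟩ := hφ
  rw [← char_tensor]
  exact IsChar.of_representation _

/-- If `e` is an idempotent commuting with the representation `ρ`, then `g ↦ tr (e ρ(g))` is the
character of the representation on the range of `e`. -/
lemma IsChar.of_idempotent {V : Type*} [AddCommGroup V] [Module ℂ V] [FiniteDimensional ℂ V]
    (ρ : Representation ℂ G V) (e : V →ₗ[ℂ] V) (he : ∀ v, e (e v) = e v)
    (hc : ∀ g v, e (ρ g v) = ρ g (e v)) : IsChar fun g => LinearMap.trace ℂ V (e ∘ₗ ρ g) := by
  let p : Subrepresentation ρ :=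
    { toSubmodule := LinearMap.range e
      apply_mem_toSubmodule := by
        rintro g _ ⟨v, rfl⟩
        exact ⟨ρ g v, hc g v⟩ }
  convert IsChar.of_representation p.toRepresentation using 1
  ext g
  rw [← LinearMap.trace_restrict_eq_of_forall_mem (LinearMap.range e) (e ∘ₗ ρ g) (fun x => ⟨_, rfl⟩)]
  unfold character
  congr 1
  ext ⟨_, v, rfl⟩
  change e (ρ g (e v)) = ρ g (e v)
  rw [hc, he]

/-- Summation of a function of `x` that only depends on the coset `H x`. -/
lemma sum_comp_coset {Ω : Type*} [Fintype G] (H : Subgroup G) (s : Finset Ω) (T : G → Ω)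
    (hT : ∀ g h, T g = T h ↔ g * h⁻¹ ∈ H) (hs : ∀ g, T g ∈ s) (hsurj : ∀ w ∈ s, ∃ g, T g = w)
    (Φ : Ω → ℂ) : ∑ x, Φ (T x) = Nat.card H * ∑ w ∈ s, Φ w := by
  classical
  rw [← Finset.sum_fiberwise_of_maps_to (fun x _ => hs x), Finset.mul_sum]
  refine Finset.sum_congr rfl fun w hw => ?_
  obtain ⟨k, rfl⟩ := hsurj w hw
  rw [Finset.sum_congr rfl (g := fun _ => Φ (T k))
    (fun x hx => by rw [(Finset.mem_filter.1 hx).2]), Finset.sum_const, nsmul_eq_mul]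
  congr 2
  rw [← Nat.card_eq_finsetCard]
  refine (Nat.card_congr (α := H) (β := {x // x ∈ Finset.univ.filter fun x => T x = T k})
    { toFun := fun h => ⟨h * k, by simp [hT]⟩
      invFun := fun x => ⟨x.1 * k⁻¹, (hT _ _).1 (Finset.mem_filter.1 x.2).2⟩
      left_inv := fun h => by simp
      right_inv := fun x => by simp }).symm

open Classical in
-- Replacing `x` by its inverse makes the summand a function of the coset `H x`, the form that
-- `sum_comp_coset` handles.
lemma ind_apply {H : Subgroup G} [Fintype G] (μ : H →* ℂˣ) (g : G) :
    ind μ g = (Nat.card H : ℂ)⁻¹ *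
      ∑ x : G, if h : x * g * x⁻¹ ∈ H then ((μ ⟨x * g * x⁻¹, h⟩ : ℂˣ) : ℂ) else 0 := by
  rw [ind, finsum_eq_sum_of_fintype]
  congr 1
  refine Fintype.sum_equiv (Equiv.inv G) _ _ fun x => ?_
  simp

variable [Finite G]

/-- The scalar product of two characters, written with inverses instead of conjugates. -/
def cip (χ φ : G → ℂ) : ℂ := (Nat.card G : ℂ)⁻¹ * ∑ᶠ g, χ g * φ g⁻¹

lemma cip_eq_finrank {V W : Type*} [AddCommGroup V] [Module ℂ V] [FiniteDimensional ℂ V]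
    [AddCommGroup W] [Module ℂ W] [FiniteDimensional ℂ W]
    (ρ : Representation ℂ G V) (σ : Representation ℂ G W) :
    cip σ.character ρ.character = finrank ℂ (IntertwiningMap ρ σ) := by
  have := Fintype.ofFinite G
  have : Invertible (Nat.card G : ℂ) := invertibleOfNonzero (by simp)
  rw [cip, finsum_eq_sum_of_fintype, card_inv_mul_sum_char_mul_char_eq_finrank]

lemma IsChar.cip_nat {χ φ : G → ℂ} (hχ : IsChar χ) (hφ : IsChar φ) : ∃ k : ℕ, cip χ φ = k := by
  obtain ⟨_, σ, rfl⟩ := hχ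
  obtain ⟨_, ρ, rfl⟩ := hφ
  exact ⟨_, cip_eq_finrank ρ σ⟩

lemma IsChar.cip_self {χ : G → ℂ} (hχ : IsChar χ) (h1 : χ 1 ≠ 0) :
    ∃ k : ℕ, 1 ≤ k ∧ cip χ χ = k := by
  obtain ⟨d, ρ, rfl⟩ := hχ
  refine ⟨_, ?_, cip_eq_finrank ρ ρ⟩
  have hd : d ≠ 0 := by
    rintro rfl
    simp at h1
  have : Nontrivial (Fin d → ℂ) := by
    have : NeZero d := ⟨hd⟩
    infer_instance
  have : Nontrivial (IntertwiningMap ρ ρ) := by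
    refine ⟨⟨0, IntertwiningMap.id ρ, fun h => ?_⟩⟩
    obtain ⟨v, hv⟩ := exists_ne (0 : Fin d → ℂ)
    exact hv (DFunLike.congr_fun h v).symm
  have : FiniteDimensional ℂ (IntertwiningMap ρ ρ) :=
    Module.Finite.equiv (invariantsEquivIntertwiningMap ρ ρ)
  exact finrank_pos

/-- Converse of Schur's lemma: by Maschke an invariant subspace has an invariant complement, and the
projection along it is an intertwiner, hence a scalar, so the subspace is zero or everything. -/
lemma IsChar.isIrr {χ : G → ℂ} (hχ : IsChar χ) (h : cip χ χ = 1) : IsIrr χ := by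
  obtain ⟨d, ρ, rfl⟩ := hχ
  refine ⟨d, ρ, ?_, rfl⟩
  rw [cip_eq_finrank] at h
  have h1 : finrank ℂ (IntertwiningMap ρ ρ) = 1 := by exact_mod_cast h
  have hid : IntertwiningMap.id ρ ≠ 0 := by
    intro h0
    have : Subsingleton (IntertwiningMap ρ ρ) := by
      refine ⟨fun f g => DFunLike.ext _ _ fun v => ?_⟩
      have hv : v = 0 := DFunLike.congr_fun h0 v
      rw [hv]
      exact (map_zero f.toLinearMap).trans (map_zero g.toLinearMap).symm
    rw [finrank_zero_of_subsingleton] at h1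
    exact zero_ne_one h1
  have hne : Nontrivial (Subrepresentation ρ) := by
    refine ⟨⟨⊥, ⊤, fun h0 => hid ?_⟩⟩
    refine DFunLike.ext _ _ fun v => ?_
    have : v ∈ (⊤ : Subrepresentation ρ).toSubmodule := trivial
    rw [← h0] at this
    exact (Submodule.mem_bot ℂ).1 this
  refine { toNontrivial := hne, eq_bot_or_eq_top := fun p => ?_ }
  have : NeZero (Nat.card G : ℂ) := ⟨by exact_mod_cast Nat.card_pos.ne'⟩
  obtain ⟨p', hp⟩ := exists_isCompl p
  have hpc : IsCompl p.toSubmodule p'.toSubmodule := by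
    constructor
    · rw [disjoint_iff]
      have := hp.inf_eq_bot
      rw [← Subrepresentation.toSubmodule_inf, this]; rfl
    · rw [codisjoint_iff, ← Subrepresentation.toSubmodule_sup, hp.sup_eq_top]; rfl
  let e := p.toSubmodule.projection p'.toSubmodule hpc
  have heq : ∀ g v, e (ρ g v) = ρ g (e v) := by
    intro g v
    obtain ⟨a, ha, b, hb, rfl⟩ : ∃ a ∈ p.toSubmodule, ∃ b ∈ p'.toSubmodule, a + b = v :=
      Submodule.mem_sup.1 (hpc.sup_eq_top ▸ Submodule.mem_top)
    have hpa : ∀ x ∈ p.toSubmodule, e x = x := fun x hx =>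
      (Submodule.projection_apply_left hpc ⟨x, hx⟩)
    have hpb : ∀ x ∈ p'.toSubmodule, e x = 0 := fun x hx =>
      (Submodule.projection_apply_eq_zero_iff hpc).2 hx
    rw [map_add, map_add, map_add, hpa _ ha, hpb _ hb, hpa _ (p.apply_mem_toSubmodule g ha),
      hpb _ (p'.apply_mem_toSubmodule g hb), add_zero, add_zero]
  let E : IntertwiningMap ρ ρ := ⟨e, fun g => LinearMap.ext (heq g)⟩
  obtain ⟨c, hc⟩ := (finrank_eq_one_iff_of_nonzero' _ hid).1 h1 E
  have hev : ∀ v, e v = c • v := fun v => (DFunLike.congr_fun hc v).symm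
  by_cases h0 : c = 0
  · left
    apply Subrepresentation.toSubmodule_injective
    refine (Submodule.eq_bot_iff _).2 fun v hv => ?_
    exact (Submodule.projection_apply_of_mem_left hpc hv).symm.trans
      ((hev v).trans (by rw [h0, zero_smul]))
  · right
    apply Subrepresentation.toSubmodule_injective
    refine Submodule.eq_top_iff'.2 fun v => ?_
    have := Submodule.projection_apply_mem hpc v
    have h2 : c • v ∈ p.toSubmodule := hev v ▸ this
    exact (Submodule.smul_mem_iff _ h0).1 h2

/-- A family of `q` characters of nonzero degree whose sum has norm at most `q` consists of
pairwise distinct irreducible characters. -/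
lemma irr_of_cip_sum_le {ι : Type*} [Fintype ι] (χ : ι → G → ℂ) (hχ : ∀ u, IsChar (χ u))
    (h1 : ∀ u, χ u 1 ≠ 0) (k : ℕ) (hk : k ≤ Fintype.card ι)
    (h : cip (∑ u, χ u) (∑ u, χ u) = k) :
    (∀ u, IsIrr (χ u)) ∧ Function.Injective χ := by
  classical
  choose m hm using fun u v => (hχ u).cip_nat (hχ v)
  -- The Gram matrix `m` has natural entries, diagonal entries at least `1` and total at most the
  -- number of characters; this forces it to be the identity matrix.
  have hmm : ∀ u, 1 ≤ m u u := fun u => by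
    obtain ⟨k, hk, e⟩ := (hχ u).cip_self (h1 u)
    rw [hm] at e
    have : m u u = k := by exact_mod_cast e
    omega
  have hs : ∑ u, ∑ v, m u v = k := by
    have : Fintype G := Fintype.ofFinite G
    have e : cip (∑ u, χ u) (∑ u, χ u) = ∑ u, ∑ v, cip (χ u) (χ v) := by
      simp only [cip, finsum_eq_sum_of_fintype, Finset.sum_apply, Finset.sum_mul_sum,
        ← Finset.mul_sum]
      congr 1
      rw [Finset.sum_comm]
      refine Finset.sum_congr rfl fun _ _ => ?_
      rw [Finset.sum_comm]
      exact Finset.sum_congr rfl fun _ _ => Finset.mul_sum ..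
    rw [h] at e
    simp only [hm] at e
    exact_mod_cast e.symm
  have hle : ∑ u, ∑ v, m u v ≤ ∑ u : ι, 1 := by simpa [hs] using hk
  have hrow : ∀ u, m u u ≤ ∑ v, m u v := fun u =>
    Finset.single_le_sum (f := fun v => m u v) (fun _ _ => Nat.zero_le _) (Finset.mem_univ u)
  have hone : ∀ u, ∑ v, m u v = 1 := by
    have hge : ∀ u ∈ Finset.univ, 1 ≤ ∑ v, m u v := fun u _ => (hmm u).trans (hrow u)
    have := (Finset.sum_eq_sum_iff_of_le hge).1 (le_antisymm (Finset.sum_le_sum hge) hle)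
    exact fun u => (this u (Finset.mem_univ u)).symm
  have hdiag : ∀ u, m u u = 1 := fun u => le_antisymm ((hrow u).trans (hone u).le) (hmm u)
  refine ⟨fun u => (hχ u).isIrr (by rw [hm, hdiag]; simp), fun u v huv => ?_⟩
  by_contra hne
  have h2 : m u u + m u v ≤ ∑ w, m u w := by
    rw [← Finset.sum_pair (f := fun w => m u w) hne]
    exact Finset.sum_le_sum_of_subset (Finset.subset_univ _)
  have h3 : (m u v : ℂ) = m u u := by rw [← hm, ← hm, huv]
  have h4 : m u v = m u u := by exact_mod_cast h3
  rw [h4, hdiag, hone] at h2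
  omega

/-! ### Induced linear characters -/

lemma unit_inv_eq_conj {H : Type*} [Group H] [Finite H] (μ : H →* ℂˣ) (h : H) :
    ((μ h⁻¹ : ℂˣ) : ℂ) = starRingEnd ℂ (μ h) := by
  have : (μ h : ℂ) ^ Nat.card H = 1 := by
    rw [← Units.val_pow_eq_pow_val, ← map_pow, pow_card_eq_one', map_one, Units.val_one]
  have hn : ‖(μ h : ℂ)‖ = 1 := Complex.norm_eq_one_of_pow_eq_one this Nat.card_pos.ne'
  rw [map_inv, Units.val_inv_eq_inv_val, Complex.inv_def, Complex.normSq_eq_norm_sq, hn]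
  simp

lemma ind_inv {H : Subgroup G} (μ : H →* ℂˣ) (g : G) :
    ind μ g⁻¹ = starRingEnd ℂ (ind μ g) := by
  classical
  have := Fintype.ofFinite G
  rw [ind_apply, ind_apply, map_mul, map_inv₀, map_sum, Complex.conj_natCast]
  congr 1
  refine Finset.sum_congr rfl fun x _ => ?_
  have e : x * g⁻¹ * x⁻¹ = (x * g * x⁻¹)⁻¹ := by group
  by_cases h : x * g * x⁻¹ ∈ H
  · rw [dif_pos h, dif_pos (e ▸ H.inv_mem h), ← unit_inv_eq_conj]
    congr 2
    exact Subtype.ext e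
  · rw [dif_neg h, dif_neg (by rw [e, H.inv_mem_iff]; exact h), map_zero]

/-- The right translation of functions on `G`. -/
def rightTranslation (G : Type*) [Group G] : Representation ℂ G (G → ℂ) where
  toFun g := LinearMap.funLeft ℂ ℂ (· * g)
  map_one' := by ext; simp [LinearMap.funLeft]
  map_mul' g h := by ext; simp [LinearMap.funLeft, mul_assoc]

/-- The operator `e` projects the functions on `G` onto those with `f (h x) = μ h * f x`, a model of
the induced representation. It commutes with right translation, and the trace in the basis of point
masses is the defining formula of `ind μ`. -/
lemma isChar_ind {H : Subgroup G} (μ : H →* ℂˣ) : IsChar (ind μ) := by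
  classical
  have := Fintype.ofFinite G
  have := Fintype.ofFinite H
  let e : (G → ℂ) →ₗ[ℂ] (G → ℂ) :=
    (Nat.card H : ℂ)⁻¹ • ∑ h : H, ((μ h⁻¹ : ℂˣ) : ℂ) • LinearMap.funLeft ℂ ℂ (fun x => (h : G) * x)
  have hea : ∀ f x, e f x = (Nat.card H : ℂ)⁻¹ * ∑ h : H, ((μ h⁻¹ : ℂˣ) : ℂ) * f (h * x) := by
    intro f x
    simp [e, LinearMap.funLeft]
  have hcard : (Nat.card H : ℂ) ≠ 0 := by simp
  have heH : ∀ f (k : H) x, e f (k * x) = μ k * e f x := by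
    intro f k x
    rw [hea, hea, mul_left_comm (μ k : ℂ), Finset.mul_sum (a := (μ k : ℂ))]
    congr 1
    refine Fintype.sum_equiv (Equiv.mulRight k) _ _ fun h => ?_
    simp only [Equiv.coe_mulRight, mul_inv_rev, map_mul, Units.val_mul, Subgroup.coe_mul, mul_assoc]
    rw [← mul_assoc (μ k : ℂ), ← Units.val_mul, ← map_mul, mul_inv_cancel, map_one, Units.val_one,
      one_mul]
  convert IsChar.of_idempotent (V := G → ℂ) (rightTranslation G) e ?_ ?_ using 1
  · ext g
    rw [LinearMap.trace_eq_matrix_trace ℂ (Pi.basisFun ℂ G), Matrix.trace, ind_apply]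
    simp only [Matrix.diag_apply, LinearMap.toMatrix_apply, Pi.basisFun_apply, Pi.basisFun_repr,
      LinearMap.comp_apply, hea, ← Finset.mul_sum]
    congr 1
    refine Finset.sum_congr rfl fun x _ => ?_
    have hk : ∀ h : H, rightTranslation G g (Pi.single x 1) ((h : G) * x)
        = if (h : G)⁻¹ = x * g * x⁻¹ then (1 : ℂ) else 0 := by
      intro h
      change Pi.single (M := fun _ => ℂ) x 1 ((h : G) * x * g) = _
      rw [Pi.single_apply]
      congr 1
      rw [eq_iff_iff]
      constructor
      · intro h1
        rw [inv_eq_iff_mul_eq_one, ← mul_assoc, ← mul_assoc, h1, mul_inv_cancel]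
      · intro h1
        rw [inv_eq_iff_mul_eq_one, ← mul_assoc, ← mul_assoc, mul_inv_eq_one] at h1
        exact h1
    simp only [hk]
    split_ifs with hx
    · rw [Finset.sum_eq_single (⟨x * g * x⁻¹, hx⟩⁻¹ : H)]
      · simp
      · intro h _ hne
        rw [if_neg, mul_zero]
        intro h1
        apply hne
        rw [← inv_eq_iff_eq_inv]
        exact Subtype.ext h1
      · simp
    · symm
      refine Finset.sum_eq_zero fun h _ => ?_
      rw [if_neg, mul_zero]
      intro h1
      exact hx (h1 ▸ H.inv_mem h.2)
  · intro f
    ext x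
    rw [hea]
    simp only [heH]
    have : ∀ h : H, ((μ h⁻¹ : ℂˣ) : ℂ) * (μ h * e f x) = e f x := by
      intro h
      rw [← mul_assoc, ← Units.val_mul, ← map_mul, inv_mul_cancel, map_one, Units.val_one, one_mul]
    simp only [this, Finset.sum_const, Finset.card_univ, nsmul_eq_mul, ← Nat.card_eq_fintype_card]
    rw [inv_mul_cancel_left₀ hcard]
  · intro g f
    ext x
    rw [hea]
    change _ = e f (x * g)
    rw [hea]
    refine congrArg _ (Finset.sum_congr rfl fun h _ => ?_)
    change _ * f (h * x * g) = _
    rw [mul_assoc (h : G)]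

end CharacterTheory

/-! ### Character sums attached to a strictly upper triangular matrix -/

section CharacterSums

open Classical Matrix Finset

variable {n : ℕ} {F : Type*} [Field F] [Fintype F]

/-- The indices strictly between `a` and `b`. -/
def between (a : Fin n) (b : ℕ) : Finset (Fin n) := univ.filter fun k => a < k ∧ (k : ℕ) < b

lemma mem_between {a k : Fin n} {b : ℕ} : k ∈ between a b ↔ a < k ∧ (k : ℕ) < b := by
  simp [between]

lemma card_between (a b : Fin n) : (between a b).card = b - a - 1 := by
  rw [← Fin.card_Ioo]
  congr 1
  ext k
  simp [mem_between]

/-- The vectors with entry `s` at `p`, arbitrary entries at `I` and zeros elsewhere. -/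
def box (p : Fin n) (s : F) (I : Finset (Fin n)) : Finset (Fin n → F) :=
  Fintype.piFinset fun k => if k = p then {s} else if k ∈ I then univ else {0}

lemma mem_box {p : Fin n} {s : F} {I : Finset (Fin n)} {x : Fin n → F} :
    x ∈ box p s I ↔ x p = s ∧ ∀ k, k ≠ p → k ∉ I → x k = 0 := by
  rw [box, Fintype.mem_piFinset]
  constructor
  · intro h
    refine ⟨by simpa using h p, fun k hk hI => by simpa [hk, hI] using h k⟩
  · rintro ⟨h1, h2⟩ k
    split_ifs with hk hI
    · simpa [hk] using h1
    · simp
    · simpa using h2 k hk hI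

lemma card_box {p : Fin n} {s : F} {I : Finset (Fin n)} (hp : p ∉ I) :
    (box p s I).card = Fintype.card F ^ I.card := by
  rw [box, Fintype.card_piFinset]
  have : ∀ k, (if k = p then {s} else if k ∈ I then univ else {0} : Finset F).card
      = if k ∈ I then Fintype.card F else 1 := by
    intro k
    by_cases hk : k = p
    · simp [hk, hp]
    · by_cases hI : k ∈ I <;> simp [hk, hI]
  simp [this]

lemma mem_box_between {a : Fin n} {b : ℕ} {s : F} {x : Fin n → F} :
    x ∈ box a s (between a b) ↔ x a = s ∧ ∀ k : Fin n, k < a ∨ (a < k ∧ b ≤ k) → x k = 0 := by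
  rw [mem_box]
  refine and_congr_right fun _ => ⟨fun h k hk => h k ?_ ?_, fun h k hk hI => h k ?_⟩
  · rintro rfl
    simp at hk
  · rw [mem_between]
    rintro ⟨h1, h2⟩
    rcases hk with hk | hk
    · exact absurd h1 hk.asymm
    · omega
  · rw [mem_between] at hI
    rcases lt_or_gt_of_ne hk with h1 | h1
    · exact Or.inl h1
    · exact Or.inr ⟨h1, not_lt.1 fun h2 => hI ⟨h1, h2⟩⟩

/-- `N` is strictly upper triangular. -/
def IsStrict (N : Matrix (Fin n) (Fin n) F) : Prop := ∀ i j, j ≤ i → N i j = 0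

/-- The vectors `x` with first nonzero entry `x a = 1`, zero from `b` on, such that `x N` vanishes
between `a` and `b`. -/
def fixRow (N : Matrix (Fin n) (Fin n) F) (a : Fin n) (b : ℕ) : Finset (Fin n → F) :=
  (box a 1 (between a b)).filter fun x => ∀ k ∈ between a b, (x ᵥ* N) k = 0

/-- The vectors supported strictly between `a` and `b` such that `x N` vanishes there. -/
def fixMid (N : Matrix (Fin n) (Fin n) F) (a : Fin n) (b : ℕ) : Finset (Fin n → F) :=
  (box a 0 (between a b)).filter fun x => ∀ k ∈ between a b, (x ᵥ* N) k = 0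

variable (ψ : AddChar F ℂ)

/-- The value of an elementary character, as a sum over row vectors. -/
def chi (N : Matrix (Fin n) (Fin n) F) (a b : Fin n) (c : F) : ℂ :=
  ∑ x ∈ fixRow N a b, ψ (c * (x ᵥ* N) b)

/-- The value of a permutation character: the number of fixed vectors. -/
def numFix (N : Matrix (Fin n) (Fin n) F) (a : Fin n) (b : ℕ) : ℂ := (fixRow N a b).card

/-- The reflection of a matrix in its antidiagonal. -/
def flip (N : Matrix (Fin n) (Fin n) F) : Matrix (Fin n) (Fin n) F :=
  fun i j => N j.rev i.rev

omit [Fintype F] in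
lemma IsStrict.flip {N : Matrix (Fin n) (Fin n) F} (hN : IsStrict N) : IsStrict (flip N) :=
  fun _ _ h => hN _ _ (Fin.rev_le_rev.2 h)

omit [Fintype F] in
lemma IsStrict.vecMul_congr {N : Matrix (Fin n) (Fin n) F} (hN : IsStrict N) {x y : Fin n → F}
    {k : Fin n} (h : ∀ l < k, x l = y l) : (x ᵥ* N) k = (y ᵥ* N) k := by
  unfold vecMul dotProduct
  refine Finset.sum_congr rfl fun l _ => ?_
  rcases lt_or_ge l k with hl | hl
  · rw [h l hl]
  · simp only [hN l k hl, mul_zero]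

omit [Fintype F] in
lemma IsStrict.vecMul_eq_zero {N : Matrix (Fin n) (Fin n) F} (hN : IsStrict N) {x : Fin n → F}
    {k : Fin n} (h : ∀ l < k, x l = 0) : (x ᵥ* N) k = 0 := by
  rw [hN.vecMul_congr (y := 0) h, Matrix.zero_vecMul, Pi.zero_apply]

lemma mem_fixRow {N : Matrix (Fin n) (Fin n) F} (hN : IsStrict N) {a : Fin n} {b : ℕ}
    {x : Fin n → F} : x ∈ fixRow N a b ↔ x a = 1 ∧
      (∀ k : Fin n, k < a ∨ (a < k ∧ b ≤ k) → x k = 0) ∧ ∀ k : Fin n, (k : ℕ) < b → (x ᵥ* N) k = 0 := by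
  rw [fixRow, mem_filter, mem_box_between, and_assoc]
  refine and_congr_right fun _ => and_congr_right fun h => ⟨fun h2 k hk => ?_, fun h2 k hk => ?_⟩
  · rcases lt_or_ge a k with h3 | h3
    · exact h2 k (mem_between.2 ⟨h3, hk⟩)
    · exact hN.vecMul_eq_zero fun l hl => h l (Or.inl (hl.trans_le h3))
  · exact h2 k (mem_between.1 hk).2

lemma mem_fixMid {N : Matrix (Fin n) (Fin n) F} (hN : IsStrict N) {a : Fin n} {b : ℕ}
    {x : Fin n → F} : x ∈ fixMid N a b ↔ x a = 0 ∧
      (∀ k : Fin n, k < a ∨ (a < k ∧ b ≤ k) → x k = 0) ∧ ∀ k : Fin n, (k : ℕ) < b → (x ᵥ* N) k = 0 := by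
  rw [fixMid, mem_filter, mem_box_between, and_assoc]
  refine and_congr_right fun _ => and_congr_right fun h => ⟨fun h2 k hk => ?_, fun h2 k hk => ?_⟩
  · rcases lt_or_ge a k with h3 | h3
    · exact h2 k (mem_between.2 ⟨h3, hk⟩)
    · exact hN.vecMul_eq_zero fun l hl => h l (Or.inl (hl.trans_le h3))
  · exact h2 k (mem_between.1 hk).2

lemma chi_zero (N : Matrix (Fin n) (Fin n) F) (a b : Fin n) : chi ψ N a b 0 = numFix N a b := by
  simp [chi, numFix]

lemma numFix_succ_self {N : Matrix (Fin n) (Fin n) F} (hN : IsStrict N) (a : Fin n) :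
    numFix N a (a + 1) = 1 := by
  have : fixRow N a (a + 1) = {Pi.single a 1} := by
    ext x
    rw [mem_fixRow hN, mem_singleton]
    constructor
    · rintro ⟨h1, h2, -⟩
      ext k
      by_cases hk : k = a
      · subst hk; simp [h1]
      · rw [Pi.single_eq_of_ne hk]
        rcases lt_or_gt_of_ne hk with h | h
        · exact h2 k (Or.inl h)
        · exact h2 k (Or.inr ⟨h, h⟩)
    · rintro rfl
      refine ⟨by simp, fun k hk => Pi.single_eq_of_ne ?_ _, fun k hk => hN.vecMul_eq_zero fun l hl =>
        Pi.single_eq_of_ne ?_ _⟩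
      · rintro rfl
        simp at hk
      · rintro rfl
        have : (l : ℕ) < k := hl
        omega
  simp [numFix, this]

lemma sum_units_add (f : F → ℂ) : ∑ c, f c = f 0 + ∑ u : Fˣ, f u := by
  rw [Fintype.sum_eq_add_sum_compl 0]
  congr 1
  symm
  refine Finset.sum_bij (fun u _ => (u : F)) (by simp) (fun _ _ _ _ h => Units.ext h) ?_ (by simp)
  intro c hc
  exact ⟨Units.mk0 c (by simpa using hc), by simp, rfl⟩

/-! ### Sums over coefficients, double sums over rows and columns, reflection. -/

variable {ψ} (hψ : ψ.IsPrimitive)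
include hψ

lemma sum_mul_char (w : F) : ∑ c, ψ (c * w) = if w = 0 then (Fintype.card F : ℂ) else 0 := by
  rw [AddChar.sum_mulShift w hψ]
  split_ifs <;> simp

/-- Summing over `c` imposes the further condition `(x N)_t = 0` with a factor `q`. That factor is
the number of choices for the entry `x_t`, which becomes free when the bound moves from `t` to `t +
1`. -/
lemma sum_chi {N : Matrix (Fin n) (Fin n) F} (hN : IsStrict N) {a t : Fin n} (hat : a < t) :
    ∑ c, chi ψ N a t c = numFix N a (t + 1) := by
  simp only [chi]
  rw [Finset.sum_comm]
  simp only [sum_mul_char hψ, ← Finset.sum_filter, sum_const, nsmul_eq_mul]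
  rw [numFix, mul_comm, ← Nat.cast_mul, ← Finset.card_univ, ← card_product]
  congr 1
  -- As `N` is strictly upper triangular, the entry `x_t` affects `x N` only to the right of `t`.
  have hup : ∀ (x : Fin n → F) (s : F) (k : Fin n), (k : ℕ) < t + 1 →
      (Function.update x t s ᵥ* N) k = (x ᵥ* N) k := fun x s k hk =>
    hN.vecMul_congr fun l hl => Function.update_of_ne (by
      rintro rfl
      have : (l : ℕ) < k := hl
      omega) _ _
  refine card_nbij' (fun p => Function.update p.2 t p.1) (fun x => (x t, Function.update x t 0))
    ?_ ?_ ?_ ?_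
  · rintro ⟨s, x⟩ h
    simp only [coe_product, coe_univ, Set.mem_prod, Set.mem_univ, true_and, mem_coe, mem_filter,
      mem_fixRow hN] at h ⊢
    obtain ⟨⟨h1, h2, h3⟩, h4⟩ := h
    refine ⟨by rwa [Function.update_of_ne hat.ne], fun k hk => ?_, fun k hk => ?_⟩
    · rw [Function.update_of_ne]
      · exact h2 k (hk.imp id (And.imp id (by omega)))
      · rintro rfl
        rcases hk with hk | hk
        · exact hk.asymm hat
        · omega
    · rw [hup _ _ _ hk]
      rcases Nat.lt_succ_iff_lt_or_eq.1 hk with h | h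
      · exact h3 k h
      · rwa [Fin.ext h]
  · intro x h
    simp only [coe_product, coe_univ, Set.mem_prod, Set.mem_univ, true_and, mem_coe, mem_filter,
      mem_fixRow hN] at h ⊢
    obtain ⟨h1, h2, h3⟩ := h
    refine ⟨⟨by rwa [Function.update_of_ne hat.ne], fun k hk => ?_, fun k hk => ?_⟩, ?_⟩
    · by_cases hkt : k = t
      · simp [hkt]
      · rw [Function.update_of_ne hkt]
        refine h2 k (hk.imp id (And.imp id fun h => ?_))
        have : (k : ℕ) ≠ t := fun h => hkt (Fin.ext h)
        omega
    · rw [hup _ _ _ (by omega)]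
      exact h3 k (by omega)
    · rw [hup _ _ _ (by omega)]
      exact h3 t (by omega)
  · rintro ⟨s, x⟩ h
    simp only [coe_product, coe_univ, Set.mem_prod, Set.mem_univ, true_and, mem_coe, mem_filter,
      mem_fixRow hN] at h
    have : x t = 0 := h.1.2.1 t (Or.inr ⟨hat, le_rfl⟩)
    simp [← this]
  · intro x _
    simp

/-- The permutation character on the row vectors as a sum of elementary characters. -/
lemma numFix_eq {N : Matrix (Fin n) (Fin n) F} (hN : IsStrict N) {a b : Fin n} (hab : a < b) :
    numFix N a b = 1 + ∑ t ∈ Ioo a b, ∑ u : Fˣ, chi ψ N a t u := by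
  have key : ∀ m : ℕ, (a : ℕ) + 1 ≤ m → m ≤ n →
      numFix N a m = 1 + ∑ t ∈ between a m, ∑ u : Fˣ, chi ψ N a t u := by
    intro m hm
    induction m, hm using Nat.le_induction with
    | base =>
      intro _
      have : between a (a + 1) = ∅ := by
        ext k
        simp only [mem_between, notMem_empty, iff_false, Fin.lt_def]
        omega
      rw [numFix_succ_self hN, this, sum_empty, add_zero]
    | succ m hm ih =>
      intro hmn
      let t : Fin n := ⟨m, hmn⟩
      have ht : a < t := hm
      have : between a (m + 1) = insert t (between a m) := by
        ext k
        simp only [mem_between, mem_insert, Fin.lt_def, Fin.ext_iff, t]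
        omega
      -- In `sum_chi` the coefficient `0` contributes the count for the bound `m`; the nonzero
      -- coefficients are the new elementary characters.
      rw [this, sum_insert (by simp [mem_between, t]), add_left_comm, ← ih (by omega),
        show m + 1 = (t : ℕ) + 1 from rfl, ← sum_chi hψ hN ht, sum_units_add, chi_zero, add_comm]
  rw [key b hab b.2.le]
  congr 2
  ext k
  simp [mem_between]

/-- The sum factors over the coordinates of `y`: a free coordinate gives `q` or `0` according to
whether `w` vanishes there, and the prescribed one only contributes a phase. -/
lemma sum_box {p : Fin n} {I : Finset (Fin n)} (hp : p ∉ I) (s : F) (w : Fin n → F) {c : F}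
    (hc : c ≠ 0) : ∑ y ∈ box p s I, ψ (c * (w ⬝ᵥ y)) =
      if ∀ k ∈ I, w k = 0 then (Fintype.card F : ℂ) ^ I.card * ψ (c * (w p * s)) else 0 := by
  have h1 : ∀ y : Fin n → F, ψ (c * (w ⬝ᵥ y)) = ∏ k, ψ (c * (w k * y k)) := by
    intro y
    rw [dotProduct, mul_sum]
    exact map_sum ψ.toAddMonoidHom _ _
  have h2 : ∀ k, ∑ t ∈ (if k = p then {s} else if k ∈ I then univ else {0} : Finset F),
      ψ (c * (w k * t)) = (if k = p then ψ (c * (w p * s)) else 1) *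
        (if k ∈ I then if w k = 0 then (Fintype.card F : ℂ) else 0 else 1) := by
    intro k
    by_cases hk : k = p
    · subst hk
      simp [hp]
    · by_cases hI : k ∈ I
      · simp only [hk, hI, if_true, if_false, one_mul]
        rw [sum_congr rfl (g := fun t => ψ (t * (c * w k))) (fun t _ => by
          rw [show t * (c * w k) = c * (w k * t) by ring]), sum_mul_char hψ]
        simp [hc]
      · simp [hk, hI]
  rw [box, sum_congr rfl fun y _ => h1 y, ← prod_univ_sum (fun k => _) fun k t => ψ (c * (w k * t))]
  simp only [h2, prod_mul_distrib, prod_ite_eq', mem_univ, if_true, prod_ite_mem, univ_inter]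
  split_ifs with h
  · rw [mul_comm, prod_congr rfl fun k hk => if_pos (h k hk), prod_const]
  · push Not at h
    obtain ⟨k, hk, hw⟩ := h
    rw [prod_eq_zero hk (if_neg hw), mul_zero]

omit hψ [Fintype F] in
lemma notMem_between_left (a : Fin n) (b : ℕ) : a ∉ between a b := by simp [mem_between]

omit hψ [Fintype F] in
lemma notMem_between_right (a b : Fin n) : b ∉ between a b := by simp [mem_between]

/-- The two-sided formula for elementary characters. -/
lemma card_pow_mul_chi (N : Matrix (Fin n) (Fin n) F) (a b : Fin n) {c : F} (hc : c ≠ 0) :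
    (Fintype.card F : ℂ) ^ (between a b).card * chi ψ N a b c =
      ∑ x ∈ box a 1 (between a b), ∑ y ∈ box b 1 (between a b), ψ (c * (x ⬝ᵥ N *ᵥ y)) := by
  simp only [dotProduct_mulVec, sum_box hψ (notMem_between_right a b) 1 _ hc, mul_one]
  rw [← sum_filter, chi, fixRow, mul_sum]

omit hψ [Fintype F] in
lemma flip_dotProduct (N : Matrix (Fin n) (Fin n) F) (x y : Fin n → F) :
    y ∘ Fin.rev ⬝ᵥ flip N *ᵥ (x ∘ Fin.rev) = x ⬝ᵥ N *ᵥ y := by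
  simp only [dotProduct, mulVec, Finset.mul_sum]
  rw [Finset.sum_comm]
  refine Fintype.sum_equiv Fin.revPerm _ _ fun i => Fintype.sum_equiv Fin.revPerm _ _ fun j => ?_
  simp only [flip, Function.comp, Fin.revPerm_apply]
  ring

omit hψ in
lemma sum_box_rev {p : Fin n} {s : F} {I J : Finset (Fin n)} (hIJ : ∀ k, k.rev ∈ J ↔ k ∈ I)
    (f : (Fin n → F) → ℂ) : ∑ x ∈ box p.rev s J, f x = ∑ x ∈ box p s I, f (x ∘ Fin.rev) := by
  have hr : ∀ x : Fin n → F, (x ∘ Fin.rev) ∘ Fin.rev = x := fun x => by ext; simp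
  refine sum_nbij' (· ∘ Fin.rev) (· ∘ Fin.rev) ?_ ?_ ?_ ?_ ?_
  · intro x hx
    rw [mem_box] at hx ⊢
    exact ⟨hx.1, fun k hk hI => hx.2 _ (by simpa using hk) (by rwa [hIJ])⟩
  · intro x hx
    rw [mem_box] at hx ⊢
    refine ⟨by simpa using hx.1, fun k hk hI => hx.2 _ ?_ (by rwa [← hIJ, Fin.rev_rev])⟩
    rintro rfl
    simp at hk
  · intro x _; exact hr x
  · intro x _; exact hr x
  · intro x _; simp only [hr]

omit hψ [Fintype F] in
lemma rev_mem_between {a b k : Fin n} : k.rev ∈ between b.rev a.rev ↔ k ∈ between a b := by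
  simp only [mem_between, Fin.rev_lt_rev, ← Fin.lt_def]
  tauto

/-- The elementary characters as sums over column vectors. -/
lemma chi_flip (N : Matrix (Fin n) (Fin n) F) (a b : Fin n) {c : F} (hc : c ≠ 0) :
    chi ψ (flip N) b.rev a.rev c = chi ψ N a b c := by
  -- Both sides, scaled by the same power of `q`, equal the double sum over `x` and `y`; the
  -- reflection merely exchanges the roles of the two vectors.
  have h1 := card_pow_mul_chi hψ (flip N) b.rev a.rev hc
  rw [sum_box_rev fun k => rev_mem_between] at h1
  simp only [sum_box_rev fun k => rev_mem_between, flip_dotProduct] at h1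
  rw [sum_comm, ← card_pow_mul_chi hψ N a b hc] at h1
  have hcard : (between b.rev a.rev).card = (between a b).card := by
    rw [card_between, card_between, Fin.val_rev, Fin.val_rev]
    omega
  rw [hcard] at h1
  exact mul_left_cancel₀ (pow_ne_zero _ (by simp)) h1

/-- Evaluate one double sum in both orders. Here the row vector has entry `0` at `a`, so summing
over it first forces `N y` to vanish between `a` and `b` and leaves no phase: what remains is a
count of fixed column vectors. -/
lemma sum_fixMid (N : Matrix (Fin n) (Fin n) F) (a b : Fin n) {c : F} (hc : c ≠ 0) :
    ∑ z ∈ fixMid N a b, ψ (c * (z ᵥ* N) b) = numFix (flip N) b.rev a.rev := by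
  have h1 : (Fintype.card F : ℂ) ^ (between a b).card * ∑ z ∈ fixMid N a b, ψ (c * (z ᵥ* N) b) =
      ∑ z ∈ box a 0 (between a b), ∑ y ∈ box b 1 (between a b), ψ (c * (z ⬝ᵥ N *ᵥ y)) := by
    simp only [dotProduct_mulVec, sum_box hψ (notMem_between_right a b) 1 _ hc, mul_one]
    rw [← sum_filter, fixMid, mul_sum]
  have h2 : ∑ z ∈ box a 0 (between a b), ∑ y ∈ box b 1 (between a b), ψ (c * (z ⬝ᵥ N *ᵥ y)) =
      (Fintype.card F : ℂ) ^ (between a b).card * numFix (flip N) b.rev a.rev := by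
    rw [sum_comm]
    simp only [fun z y : Fin n → F => dotProduct_comm z (N *ᵥ y),
      sum_box hψ (notMem_between_left a b) 0 _ hc, mul_zero, AddChar.map_zero_eq_one, mul_one]
    rw [numFix, fixRow, card_filter, Nat.cast_sum, sum_box_rev fun k => rev_mem_between, mul_sum]
    refine sum_congr rfl fun y _ => ?_
    rw [Nat.cast_ite, Nat.cast_one, Nat.cast_zero, mul_ite, mul_one, mul_zero]
    refine if_congr ?_ rfl rfl
    have hv : ∀ k, ((y ∘ Fin.rev) ᵥ* flip N) k.rev = (N *ᵥ y) k := by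
      intro k
      simp only [vecMul, mulVec, dotProduct]
      refine Fintype.sum_equiv Fin.revPerm _ _ fun i => ?_
      simp only [flip, Function.comp, Fin.revPerm_apply, Fin.rev_rev]
      ring
    constructor
    · intro h k hk
      rw [← Fin.rev_rev k, hv]
      exact h _ (rev_mem_between.1 (by rwa [Fin.rev_rev]))
    · intro h k hk
      rw [← hv]
      exact h _ (rev_mem_between.2 hk)
  exact mul_left_cancel₀ (pow_ne_zero _ (by simp)) (h1.trans h2)

/-! ### Products of two character sums sharing a column or a root. -/

omit hψ in
-- A vector `x` in `fixRow N a b` starts to the right of `a'`, so adding a multiple of it preserves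
-- `fixRow N a' b`. The translation by `(c / c') • x` absorbs the phase `ψ (c * (x N)_b)`, so each
-- `x` contributes the same amount.
lemma chi_mul_chi_same_col {N : Matrix (Fin n) (Fin n) F} (hN : IsStrict N) {a a' b : Fin n}
    (ha : a' < a) (hab : a < b) (c : F) {c' : F} (hc : c' ≠ 0) :
    chi ψ N a b c * chi ψ N a' b c' = numFix N a b * chi ψ N a' b c' := by
  rw [chi, numFix, sum_mul, card_eq_sum_ones, Nat.cast_sum, sum_mul]
  refine sum_congr rfl fun x hx => ?_
  rw [Nat.cast_one, one_mul, chi, mul_sum]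
  rw [mem_fixRow hN] at hx
  obtain ⟨-, hx2, hx3⟩ := hx
  have hmem : ∀ (s : F) (y : Fin n → F), y ∈ fixRow N a' b → y + s • x ∈ fixRow N a' b := by
    intro s y hy
    rw [mem_fixRow hN] at hy ⊢
    obtain ⟨hy1, hy2, hy3⟩ := hy
    refine ⟨by simp [hy1, hx2 a' (Or.inl ha)], fun k hk => ?_, fun k hk => ?_⟩
    · rw [Pi.add_apply, hy2 k hk, zero_add, Pi.smul_apply, smul_eq_mul]
      rcases hk with hk | ⟨hk, hkb⟩
      · rw [hx2 k (Or.inl (hk.trans ha)), mul_zero]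
      · rcases lt_trichotomy k a with h | h | h
        · rw [hx2 k (Or.inl h), mul_zero]
        · exact absurd (h ▸ hkb) (not_le.2 hab)
        · rw [hx2 k (Or.inr ⟨h, hkb⟩), mul_zero]
    · rw [Matrix.add_vecMul, Matrix.smul_vecMul, Pi.add_apply, Pi.smul_apply, hx3 k hk, hy3 k hk]
      simp
  refine sum_nbij' (fun y => y + (c / c') • x) (fun y => y + (-(c / c')) • x)
    (hmem _) (hmem _) (fun y _ => by simp) (fun y _ => by simp) fun y _ => ?_
  rw [← AddChar.map_add_eq_mul, Matrix.add_vecMul, Matrix.smul_vecMul, Pi.add_apply, Pi.smul_apply,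
    smul_eq_mul]
  congr 1
  field_simp
  ring

omit hψ in
-- The set `fixMid` is the space of differences of vectors in `fixRow`; substitute `y = x + z`.
lemma chi_mul_chi_same_root {N : Matrix (Fin n) (Fin n) F} (hN : IsStrict N) (a b : Fin n)
    (c c' : F) : chi ψ N a b c * chi ψ N a b c' =
      ∑ z ∈ fixMid N a b, ∑ x ∈ fixRow N a b, ψ ((c + c') * (x ᵥ* N) b + c' * (z ᵥ* N) b) := by
  rw [chi, chi, sum_mul_sum, sum_comm (s := fixMid N a b)]
  refine sum_congr rfl fun x hx => ?_
  rw [mem_fixRow hN] at hx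
  refine sum_nbij' (fun y => y - x) (fun z => x + z) ?_ ?_ (fun y _ => by simp) (fun y _ => by simp)
    fun y _ => ?_
  · intro y hy
    rw [mem_fixRow hN] at hy
    rw [mem_fixMid hN]
    refine ⟨by simp [hx.1, hy.1], fun k hk => by simp [hx.2.1 k hk, hy.2.1 k hk], fun k hk => ?_⟩
    rw [Matrix.sub_vecMul, Pi.sub_apply, hx.2.2 k hk, hy.2.2 k hk, sub_zero]
  · intro y hy
    rw [mem_fixMid hN] at hy
    rw [mem_fixRow hN]
    refine ⟨by simp [hx.1, hy.1], fun k hk => by simp [hx.2.1 k hk, hy.2.1 k hk], fun k hk => ?_⟩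
    rw [Matrix.add_vecMul, Pi.add_apply, hx.2.2 k hk, hy.2.2 k hk, add_zero]
  · rw [← AddChar.map_add_eq_mul, Matrix.sub_vecMul, Pi.sub_apply]
    congr 1
    ring

/-- Opposite coefficients cancel the phase in `x`, so the sum over `x` counts fixed rows, while the
sum over `z` counts fixed columns by `sum_fixMid`. -/
lemma chi_mul_chi_neg {N : Matrix (Fin n) (Fin n) F} (hN : IsStrict N) (a b : Fin n)
    {c : F} (hc : c ≠ 0) : chi ψ N a b (-c) * chi ψ N a b c =
      numFix N a b * numFix (flip N) b.rev a.rev := by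
  rw [chi_mul_chi_same_root hN, ← sum_fixMid hψ N a b hc, mul_sum]
  refine sum_congr rfl fun z _ => ?_
  simp [numFix]

omit hψ in
-- Since `c + c'` is invertible, shifting `x` by `(c' / (c + c')) • z` absorbs the phase in `z`, so
-- only the number of the `z` matters.
lemma chi_mul_chi_add {N : Matrix (Fin n) (Fin n) F} (hN : IsStrict N) (a b : Fin n)
    {c c' : F} (hc : c + c' ≠ 0) : chi ψ N a b c * chi ψ N a b c' =
      (fixMid N a b).card * chi ψ N a b (c + c') := by
  rw [chi_mul_chi_same_root hN, ← nsmul_eq_mul, ← sum_const]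
  refine sum_congr rfl fun z hz => ?_
  rw [mem_fixMid hN] at hz
  have hmem : ∀ (s : F) (y : Fin n → F), y ∈ fixRow N a b → y + s • z ∈ fixRow N a b := by
    intro s y hy
    rw [mem_fixRow hN] at hy ⊢
    refine ⟨by simp [hy.1, hz.1], fun k hk => by simp [hy.2.1 k hk, hz.2.1 k hk], fun k hk => ?_⟩
    rw [Matrix.add_vecMul, Matrix.smul_vecMul, Pi.add_apply, Pi.smul_apply, hy.2.2 k hk,
      hz.2.2 k hk]
    simp
  refine sum_nbij' (fun y => y + (c' / (c + c')) • z) (fun y => y + (-(c' / (c + c'))) • z)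
    (hmem _) (hmem _) (fun y _ => by simp) (fun y _ => by simp) fun y _ => ?_
  rw [Matrix.add_vecMul, Matrix.smul_vecMul, Pi.add_apply, Pi.smul_apply, smul_eq_mul]
  congr 1
  field_simp

omit hψ in
/-- The fixed vectors supported strictly between `a` and `b`, sorted by their first nonzero entry. -/
lemma card_fixMid {N : Matrix (Fin n) (Fin n) F} (hN : IsStrict N) (a b : Fin n) :
    ((fixMid N a b).card : ℂ) =
      1 + ((Fintype.card F : ℂ) - 1) * ∑ r ∈ Ioo a b, numFix N r b := by
  let S : ℕ → Finset (Fin n → F) := fun m => univ.filter fun z =>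
    (∀ k : Fin n, (k : ℕ) < m ∨ b ≤ k → z k = 0) ∧ ∀ k < b, (z ᵥ* N) k = 0
  have hS : ∀ m z, z ∈ S m ↔
      (∀ k : Fin n, (k : ℕ) < m ∨ b ≤ k → z k = 0) ∧ ∀ k < b, (z ᵥ* N) k = 0 := by simp [S]
  -- Either the entry at `r` vanishes, or dividing by it, one of `q - 1` possible values, gives a
  -- vector with leading entry `1` at `r`.
  have hstep : ∀ r : Fin n, r < b →
      (S r).card = (S (r + 1)).card + (univ.erase (0 : F)).card * (fixRow N r b).card := by
    intro r hr
    rw [← card_filter_add_card_filter_not (s := S r) (fun z => z r = 0), ← card_product]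
    congr 1
    · congr 1
      ext z
      rw [mem_filter, hS, hS]
      constructor
      · rintro ⟨⟨h1, h2⟩, h3⟩
        refine ⟨fun k hk => ?_, h2⟩
        by_cases hkr : k = r
        · rwa [hkr]
        · have : (k : ℕ) ≠ r := fun h => hkr (Fin.ext h)
          exact h1 k (hk.imp (by omega) id)
      · rintro ⟨h1, h2⟩
        exact ⟨⟨fun k hk => h1 k (hk.imp (by omega) id), h2⟩, h1 r (Or.inl (by omega))⟩
    · refine card_nbij' (fun z => (z r, (z r)⁻¹ • z)) (fun p => p.1 • p.2) ?_ ?_ ?_ ?_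
      · intro z hz
        simp only [mem_coe, mem_filter, hS, coe_product, Set.mem_prod, mem_erase, mem_univ,
          and_true, mem_fixRow hN] at hz ⊢
        obtain ⟨⟨h1, h2⟩, h3⟩ := hz
        refine ⟨h3, by simp [h3], fun k hk => ?_, fun k hk => ?_⟩
        · rw [Pi.smul_apply, h1 k (hk.imp id fun h => h.2), smul_zero]
        · rw [Matrix.smul_vecMul, Pi.smul_apply, h2 k hk, smul_zero]
      · rintro ⟨s, x⟩ hx
        simp only [mem_coe, mem_filter, hS, coe_product, Set.mem_prod, mem_erase, mem_univ,
          and_true, mem_fixRow hN] at hx ⊢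
        obtain ⟨h0, h1, h2, h3⟩ := hx
        refine ⟨⟨fun k hk => ?_, fun k hk => ?_⟩, by simpa [h1] using h0⟩
        · rw [Pi.smul_apply, h2 k (hk.imp id fun h => ⟨hr.trans_le h, h⟩), smul_zero]
        · rw [Matrix.smul_vecMul, Pi.smul_apply, h3 k hk, smul_zero]
      · intro z hz
        simp only [mem_coe, mem_filter] at hz
        simp [hz.2]
      · rintro ⟨s, x⟩ hx
        simp only [mem_coe, coe_product, Set.mem_prod, mem_erase, mem_univ,
          and_true, mem_fixRow hN] at hx
        obtain ⟨h0, h1, -⟩ := hx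
        simp [h1, h0]
  -- Descending induction on the first admissible index `b - d`, starting from the zero vector alone
  -- at `d = 0`.
  have key : ∀ d : ℕ, d ≤ b → ((S (b - d)).card : ℂ) = 1 + ((Fintype.card F : ℂ) - 1) *
      ∑ r ∈ univ.filter (fun r : Fin n => (b : ℕ) - d ≤ r ∧ r < b), numFix N r b := by
    intro d
    induction d with
    | zero =>
      intro _
      have h0 : S (b - 0) = {0} := by
        ext z
        rw [hS, mem_singleton]
        constructor
        · rintro ⟨h1, -⟩
          ext k
          exact h1 k ((lt_or_ge k b).imp id id)
        · rintro rfl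
          simp
      have h1 : univ.filter (fun r : Fin n => (b : ℕ) - 0 ≤ r ∧ r < b) = ∅ := by
        ext r
        simp only [mem_filter, mem_univ, true_and, notMem_empty, iff_false, Fin.lt_def]
        omega
      rw [h0, h1]
      simp
    | succ d ih =>
      intro hd
      let r : Fin n := ⟨b - (d + 1), by omega⟩
      have hr : r < b := by
        change (b : ℕ) - (d + 1) < b
        omega
      have h1 : univ.filter (fun r : Fin n => (b : ℕ) - (d + 1) ≤ r ∧ r < b) =
          insert r (univ.filter (fun r : Fin n => (b : ℕ) - d ≤ r ∧ r < b)) := by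
        ext k
        simp only [mem_filter, mem_univ, true_and, mem_insert, Fin.ext_iff, Fin.lt_def, r]
        omega
      have hrd : (r : ℕ) + 1 = b - d := by
        change (b : ℕ) - (d + 1) + 1 = _
        omega
      rw [h1, sum_insert (by simp only [mem_filter]; omega), mul_add, add_left_comm, ← ih (by omega),
        show (b : ℕ) - (d + 1) = r from rfl, hstep r hr, hrd, card_erase_of_mem (mem_univ _),
        card_univ, Nat.cast_add, Nat.cast_mul, Nat.cast_sub Fintype.card_pos, numFix, add_comm]
      simp
  by_cases hab : a < b
  · have e := key (b - (a + 1)) (by omega)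
    have h1 : (b : ℕ) - (b - (a + 1)) = a + 1 := by
      have : (a : ℕ) < b := hab
      omega
    rw [h1] at e
    have h2 : fixMid N a b = S (a + 1) := by
      ext z
      rw [hS, mem_fixMid hN]
      constructor
      · rintro ⟨h0, h1, h2⟩
        refine ⟨fun k hk => ?_, h2⟩
        rcases lt_trichotomy k a with h | h | h
        · exact h1 k (Or.inl h)
        · rwa [h]
        · exact h1 k (Or.inr ⟨h, hk.resolve_left (by have : (a : ℕ) < k := h; omega)⟩)
      · rintro ⟨h1, h2⟩
        refine ⟨h1 a (Or.inl (by omega)), fun k hk => h1 k ?_, h2⟩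
        rcases hk with hk | hk
        · have : (k : ℕ) < a := hk
          exact Or.inl (by omega)
        · exact Or.inr hk.2
    rw [h2, e]
    congr 3
    ext r
    simp
  · have h1 : fixMid N a b = {0} := by
      ext z
      rw [mem_fixMid hN, mem_singleton]
      constructor
      · rintro ⟨h0, h1, -⟩
        ext k
        rcases lt_trichotomy k a with h | h | h
        · exact h1 k (Or.inl h)
        · rwa [h]
        · refine h1 k (Or.inr ⟨h, ?_⟩)
          have := not_lt.1 hab
          exact (this.trans h.le)
      · rintro rfl
        simp
    rw [h1, Finset.Ioo_eq_empty hab]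
    simp

end CharacterSums

/-! ### Coordinates on the unitriangular group -/

section Coordinates

open Classical Matrix Finset

variable {n : ℕ} {F : Type*} [Field F]

/-- The matrix of an element of `U n F`. -/
def val (g : U n F) : Matrix (Fin n) (Fin n) F := ((g : GL (Fin n) F) : Matrix (Fin n) (Fin n) F)

lemma val_mul (g h : U n F) : val (g * h) = val g * val h := rfl

lemma val_one : val (1 : U n F) = 1 := rfl

lemma val_injective : Function.Injective (val : U n F → Matrix (Fin n) (Fin n) F) :=
  fun _ _ h => Subtype.ext (Units.ext h)

lemma val_diag (g : U n F) (a : Fin n) : val g a a = 1 := g.2.1 a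

lemma val_lower (g : U n F) {a b : Fin n} (h : b < a) : val g a b = 0 := g.2.2 a b h

/-- The strictly upper triangular part of a unitriangular matrix. -/
def nil (g : U n F) : Matrix (Fin n) (Fin n) F := val g - 1

lemma isStrict_nil (g : U n F) : IsStrict (nil g) := by
  intro i j h
  rcases h.lt_or_eq with h | rfl
  · simp [nil, val_lower g h, Matrix.one_apply_ne h.ne']
  · simp [nil, val_diag]

lemma nil_apply (g : U n F) {i j : Fin n} (h : i < j) : nil g i j = val g i j := by
  simp [nil, Matrix.one_apply_ne h.ne]

lemma PosRoot.row_lt_col (α : PosRoot n) : α.row < α.col := α.2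

/-- The coordinates of an element of `U n F`. -/
def coord (g : U n F) (α : PosRoot n) : F := val g α.row α.col

/-- The unitriangular matrix with given entries above the diagonal. -/
def upper (v : PosRoot n → F) : Matrix (Fin n) (Fin n) F := fun a b =>
  if h : a < b then v ⟨(a, b), h⟩ else if a = b then 1 else 0

lemma det_upper (v : PosRoot n → F) : (upper v).det = 1 := by
  rw [Matrix.det_of_isUpperTriangular]
  · simp [upper]
  · intro a b h
    simp only [id] at h
    simp [upper, h.asymm, h.ne']

/-- The element of `U n F` with given coordinates. -/
def ofCoord (v : PosRoot n → F) : U n F :=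
  ⟨Matrix.GeneralLinearGroup.mkOfDetNeZero (upper v) (by rw [det_upper]; exact one_ne_zero),
    fun a => by simp [Matrix.GeneralLinearGroup.mkOfDetNeZero, upper],
    fun a b h => by simp [Matrix.GeneralLinearGroup.mkOfDetNeZero, upper, h.asymm, h.ne']⟩

lemma val_ofCoord (v : PosRoot n → F) : val (ofCoord v) = upper v := rfl

lemma val_ofCoord_apply (v : PosRoot n → F) {a b : Fin n} (h : a < b) :
    val (ofCoord v) a b = v ⟨(a, b), h⟩ := by
  simp [val_ofCoord, upper, h]

lemma coord_ofCoord (v : PosRoot n → F) : coord (ofCoord v) = v := by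
  ext α
  exact val_ofCoord_apply v α.2

lemma val_ext {g h : U n F} (H : ∀ a b, a < b → val g a b = val h a b) : g = h := by
  apply val_injective
  ext a b
  rcases lt_trichotomy a b with hab | rfl | hab
  · exact H a b hab
  · rw [val_diag, val_diag]
  · rw [val_lower g hab, val_lower h hab]

/-- Elements of `U n F` are determined by their coordinates. -/
def coordEquiv : U n F ≃ (PosRoot n → F) where
  toFun := coord
  invFun := ofCoord
  left_inv _ := val_ext fun _ _ h => val_ofCoord_apply _ h
  right_inv := coord_ofCoord

/-- The root element with entry `c` at `α`. -/
def rootElt (α : PosRoot n) (c : F) : U n F := ofCoord (Pi.single α c)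

lemma val_rootElt (α : PosRoot n) (c : F) :
    val (rootElt α c) = 1 + Matrix.single α.row α.col c := by
  ext a b
  rw [rootElt, val_ofCoord, upper, Matrix.add_apply, Matrix.one_apply, Matrix.single_apply]
  by_cases hab : a < b
  · rw [dif_pos hab, if_neg hab.ne, zero_add, Pi.single_apply]
    refine if_congr ?_ rfl rfl
    rw [Subtype.ext_iff, Prod.ext_iff]
    exact and_congr eq_comm eq_comm
  · rw [dif_neg hab]
    have : ¬(α.row = a ∧ α.col = b) := by
      rintro ⟨rfl, rfl⟩
      exact hab α.2
    rw [if_neg this, add_zero]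

lemma mem_X {α : PosRoot n} {g : U n F} : g ∈ X F α ↔ ∃ c, g = rootElt α c := by
  refine exists_congr fun c => ?_
  change val g = _ ↔ _
  rw [← val_rootElt]
  exact val_injective.eq_iff

lemma rootElt_mem_X (α : PosRoot n) (c : F) : rootElt α c ∈ X F α := mem_X.2 ⟨c, rfl⟩

lemma coord_rootElt (α : PosRoot n) (c : F) : coord (rootElt α c) = Pi.single α c :=
  coord_ofCoord _

lemma rootElt_add (α : PosRoot n) (c d : F) :
    rootElt α (c + d) = rootElt α c * rootElt α d := by
  apply val_injective
  rw [val_mul, val_rootElt, val_rootElt, val_rootElt]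
  exact (Matrix.transvection_mul_transvection_same (R := F) α.row α.col (ne_of_lt α.2) c d).symm

lemma rootElt_zero (α : PosRoot n) : rootElt α (0 : F) = 1 := by
  apply val_injective
  rw [val_rootElt, val_one, Matrix.single_zero, add_zero]

/-! ### Pattern groups -/

/-- If `g` is supported on `S`, then it lies in the group generated by the root subgroups of `S`. -/
lemma mem_gen_of_support {S : Set (PosRoot n)} {g : U n F} (hg : ∀ α ∉ S, coord g α = 0) :
    g ∈ gen F S := by
  induction hm : (univ.filter fun α => coord g α ≠ 0).card using Nat.strong_induction_on
    generalizing g with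
  | _ m ih =>
  rcases (univ.filter fun α => coord g α ≠ 0).eq_empty_or_nonempty with he | hne
  · have : g = 1 := by
      refine val_ext fun a b hab => ?_
      rw [val_one, Matrix.one_apply_ne hab.ne]
      by_contra h
      have : (⟨(a, b), hab⟩ : PosRoot n) ∈ univ.filter fun α => coord g α ≠ 0 := by
        rw [mem_filter]
        exact ⟨mem_univ _, h⟩
      rw [he] at this
      exact notMem_empty _ this
    rw [this]
    exact one_mem _
  -- With `α` in the lowest row containing a nonzero entry, the row of `g` with index `α.col` is
  -- that of the identity. Multiplying on the left by a root element at `α` therefore clears that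
  -- single entry.
  · obtain ⟨α, hα, hmax⟩ := exists_max_image _ (fun α : PosRoot n => α.row) hne
    simp only [mem_filter, mem_univ, true_and] at hα hmax
    have hαS : α ∈ S := by
      by_contra h
      exact hα (hg α h)
    set g' := rootElt α (-coord g α) * g with hg'
    have hrow : ∀ k, val g α.col k = (1 : Matrix (Fin n) (Fin n) F) α.col k := by
      intro k
      rcases lt_trichotomy α.col k with h | rfl | h
      · rw [Matrix.one_apply_ne h.ne]
        by_contra h'
        exact absurd (hmax ⟨(α.col, k), h⟩ h') (not_le.2 α.2)
      · rw [val_diag, Matrix.one_apply_eq]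
      · rw [val_lower g h, Matrix.one_apply_ne h.ne']
    have hc : ∀ β, coord g' β = if β = α then 0 else coord g β := by
      intro β
      change val g' β.row β.col = _
      rw [hg', val_mul, val_rootElt, add_mul, one_mul, Matrix.add_apply]
      by_cases hr : β.row = α.row
      · rw [hr, Matrix.single_mul_apply_same, hrow]
        by_cases hcol : β.col = α.col
        · have : β = α := Subtype.ext (Prod.ext hr hcol)
          rw [if_pos this, hcol, Matrix.one_apply_eq, mul_one]
          exact add_neg_cancel _
        · rw [if_neg (fun h => hcol (congrArg PosRoot.col h)),
            Matrix.one_apply_ne (Ne.symm hcol), mul_zero, add_zero,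
            ← hr]
          rfl
      · rw [Matrix.single_mul_apply_of_ne _ _ _ _ _ hr, add_zero,
          if_neg (fun h => hr (congrArg PosRoot.row h))]
        rfl
    have hmem : g' ∈ gen F S := by
      refine ih _ ?_ (fun β hβ => ?_) rfl
      · rw [← hm]
        refine card_lt_card ⟨fun β => ?_, fun h => ?_⟩
        · simp only [mem_filter, mem_univ, true_and, hc]
          intro h h'
          simp [h'] at h
        · have := h (by simpa using hα : α ∈ _)
          simp [hc] at this
      · rw [hc]
        split_ifs
        · rfl
        · exact hg β hβ
    have : g = rootElt α (coord g α) * g' := by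
      rw [hg', ← mul_assoc, ← rootElt_add, add_neg_cancel, rootElt_zero, one_mul]
    rw [this]
    exact mul_mem (Subgroup.mem_iSup_of_mem α (Subgroup.mem_iSup_of_mem hαS (rootElt_mem_X _ _))) hmem

/-- A set of roots closed under addition. -/
def IsClosedRoots (S : Set (PosRoot n)) : Prop :=
  ∀ (r s t : Fin n) (h1 : r < s) (h2 : s < t), (⟨(r, s), h1⟩ : PosRoot n) ∈ S →
    (⟨(s, t), h2⟩ : PosRoot n) ∈ S → (⟨(r, t), h1.trans h2⟩ : PosRoot n) ∈ S

/-- A subset of a finite group which contains `1` and is closed under multiplication is a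
subgroup. -/
def subgroupOfMul {G : Type*} [Group G] [Finite G] (S : Set G) (h1 : 1 ∈ S)
    (hm : ∀ g h, g ∈ S → h ∈ S → g * h ∈ S) : Subgroup G where
  carrier := S
  one_mem' := h1
  mul_mem' := fun {g h} => hm g h
  inv_mem' := by
    intro g hg
    have hpow : ∀ k : ℕ, g ^ k ∈ S := by
      intro k
      induction k with
      | zero => simpa using h1
      | succ k ih => rw [pow_succ]; exact hm _ _ ih hg
    have : g⁻¹ = g ^ (Nat.card G - 1) := by
      rw [inv_eq_iff_mul_eq_one, ← pow_succ', Nat.sub_add_cancel Nat.card_pos, pow_card_eq_one']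
    rw [this]
    exact hpow _

/-- The pattern group of a closed set of roots. -/
def pattern (F : Type*) [Field F] [Finite F] (S : Set (PosRoot n)) (hS : IsClosedRoots S) :
    Subgroup (U n F) :=
  subgroupOfMul {g | ∀ α ∉ S, coord g α = 0}
    (fun α _ => by
      change val 1 α.row α.col = 0
      rw [val_one, Matrix.one_apply_ne α.row_lt_col.ne])
    (fun g h hg hh α hα => by
      change val (g * h) α.row α.col = 0
      rw [val_mul, Matrix.mul_apply]
      refine Finset.sum_eq_zero fun k _ => ?_
      rcases lt_trichotomy k α.row with h1 | h1 | h1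
      · rw [val_lower g h1, zero_mul]
      · rw [h1, val_diag, one_mul]
        exact hh α hα
      · rcases lt_trichotomy k α.col with h2 | h2 | h2
        · by_contra hne
          refine hα (hS α.row k α.col h1 h2 ?_ ?_)
          · by_contra h3
            exact hne (by rw [show val g α.row k = 0 from hg _ h3, zero_mul])
          · by_contra h3
            exact hne (by rw [show val h k α.col = 0 from hh _ h3, mul_zero])
        · rw [h2, val_diag, mul_one]
          exact hg α hα
        · rw [val_lower h h2, mul_zero])

lemma mem_pattern [Finite F] {S : Set (PosRoot n)} {hS : IsClosedRoots S} {g : U n F} :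
    g ∈ pattern F S hS ↔ ∀ α ∉ S, coord g α = 0 := Iff.rfl

lemma gen_eq_pattern [Finite F] {S : Set (PosRoot n)} (hS : IsClosedRoots S) :
    gen F S = pattern F S hS := by
  refine le_antisymm (iSup₂_le fun β hβ g hg α hα => ?_) fun g hg => mem_gen_of_support hg
  obtain ⟨c, rfl⟩ := mem_X.1 hg
  rw [coord_rootElt, Pi.single_eq_of_ne]
  rintro rfl
  exact hα hβ

lemma mem_gen [Finite F] {S : Set (PosRoot n)} (hS : IsClosedRoots S) {g : U n F} :
    g ∈ gen F S ↔ ∀ α ∉ S, coord g α = 0 := by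
  rw [gen_eq_pattern hS, mem_pattern]

namespace PosRoot

lemma mem_arm {α β : PosRoot n} : β ∈ α.arm ↔ β.row = α.row ∧ β.col < α.col := by
  simp only [arm, i, j, Finset.mem_filter, Finset.mem_univ, true_and, Fin.ext_iff, Fin.lt_def,
    Nat.add_right_cancel_iff]

lemma mem_leg {α β : PosRoot n} : β ∈ α.leg ↔ β.col = α.col ∧ α.row < β.row := by
  simp only [leg, i, j, Finset.mem_filter, Finset.mem_univ, true_and, Fin.ext_iff, Fin.lt_def,
    Nat.add_lt_add_iff_right]

lemma ext_iff' {α β : PosRoot n} : α = β ↔ α.row = β.row ∧ α.col = β.col := by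
  rw [Subtype.ext_iff, Prod.ext_iff]
  rfl

end PosRoot

/-- If the sum of two roots lies in the arm, the first summand starts in the same row and ends
further left, so it lies in the arm already. -/
lemma isClosedRoots_notMem_arm (α : PosRoot n) : IsClosedRoots {β | β ∉ α.arm} := by
  intro r s t h1 h2 hrs hst hrt
  simp only [Set.mem_ofPred_eq] at hrs
  rw [PosRoot.mem_arm] at hrs hrt
  exact hrs ⟨hrt.1, h2.trans hrt.2⟩

lemma mem_baseGroup [Finite F] {α : PosRoot n} {g : U n F} :
    g ∈ baseGroup F α ↔ ∀ k, α.row < k → k < α.col → val g α.row k = 0 := by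
  rw [baseGroup, mem_gen (isClosedRoots_notMem_arm α)]
  simp only [Set.mem_ofPred_eq, not_not, PosRoot.mem_arm]
  constructor
  · intro h k h1 h2
    exact h ⟨(α.row, k), h1⟩ ⟨rfl, h2⟩
  · rintro h β ⟨h1, h2⟩
    change val g β.row β.col = 0
    rw [h1]
    exact h _ (h1 ▸ β.2) h2

/-! ### Linear characters of base groups -/

lemma rootElt_mem_baseGroup [Finite F] {α β : PosRoot n} (h : β ∉ α.arm) (c : F) :
    rootElt β c ∈ baseGroup F α :=
  Subgroup.mem_iSup_of_mem β (Subgroup.mem_iSup_of_mem h (rootElt_mem_X _ _))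

/-- To the left of `α` the row of `α` in `v` is a unit row, so left multiplication by `v` does not
change that part of a row. -/
lemma val_mul_of_mem_baseGroup [Finite F] {α : PosRoot n} {v : U n F} (hv : v ∈ baseGroup F α)
    (h : U n F) {k : Fin n} (hk : k < α.col) : val (v * h) α.row k = val h α.row k := by
  rw [mem_baseGroup] at hv
  rw [val_mul, Matrix.mul_apply, Finset.sum_eq_single α.row, val_diag, one_mul]
  · intro l _ hl
    rcases lt_or_gt_of_ne hl with h1 | h1
    · rw [val_lower v h1, zero_mul]
    · rcases lt_or_ge l α.col with h2 | h2
      · rw [hv l h1 h2, zero_mul]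
      · rw [val_lower h (hk.trans_le h2), mul_zero]
  · simp

/-- Only the diagonal terms survive in the product. This additivity makes `v ↦ ψ (v_α)`
multiplicative on the base group. -/
lemma val_mul_col_of_mem_baseGroup [Finite F] {α : PosRoot n} {v : U n F}
    (hv : v ∈ baseGroup F α) (h : U n F) : val (v * h) α.row α.col = coord v α + coord h α := by
  rw [mem_baseGroup] at hv
  rw [val_mul, Matrix.mul_apply, ← Finset.sum_subset (Finset.subset_univ {α.row, α.col}),
    Finset.sum_pair α.row_lt_col.ne, val_diag, val_diag, one_mul, mul_one, add_comm]
  · rfl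
  · intro l _ hl
    simp only [mem_insert, mem_singleton, not_or] at hl
    rcases lt_or_gt_of_ne hl.1 with h1 | h1
    · rw [val_lower v h1, zero_mul]
    · rcases lt_or_gt_of_ne hl.2 with h2 | h2
      · rw [hv l h1 h2, zero_mul]
      · rw [val_lower h h2, mul_zero]

/-- The linear character `v ↦ ψ v_α` of the base group at `α`. -/
def baseHom [Finite F] (α : PosRoot n) (ψ : AddChar F ℂ) : baseGroup F α →* ℂˣ :=
  MonoidHom.toHomUnits
    { toFun := fun v => ψ (coord (v : U n F) α)
      map_one' := by
        rw [Subgroup.coe_one, ← rootElt_zero α, coord_rootElt, Pi.single_eq_same,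
          AddChar.map_zero_eq_one]
      map_mul' := fun v w => by
        rw [← AddChar.map_add_eq_mul, Subgroup.coe_mul, ← val_mul_col_of_mem_baseGroup v.2]
        rfl }

lemma baseHom_apply [Finite F] (α : PosRoot n) (ψ : AddChar F ℂ) (v : baseGroup F α) :
    ((baseHom α ψ v : ℂˣ) : ℂ) = ψ (coord (v : U n F) α) := rfl

lemma notMem_arm_self (α : PosRoot n) : α ∉ α.arm := by
  simp [PosRoot.mem_arm]

lemma X_le_baseGroup_iff [Finite F] {α β : PosRoot n} : X F β ≤ baseGroup F α ↔ β ∉ α.arm := by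
  constructor
  · intro h hβ
    have h1 := h (rootElt_mem_X β (1 : F))
    rw [baseGroup, mem_gen (isClosedRoots_notMem_arm α)] at h1
    have := h1 β (by simpa using hβ)
    rw [coord_rootElt, Pi.single_eq_same] at this
    exact one_ne_zero this
  · intro h g hg
    obtain ⟨c, rfl⟩ := mem_X.1 hg
    exact rootElt_mem_baseGroup h c

variable [Fintype F] {ψ : AddChar F ℂ} (hψ : ψ.IsPrimitive)

include hψ in
-- The map `c ↦ ψ.mulShift c` is injective by primitivity, and there are as many additive characters
-- as elements of `F`.
lemma exists_mulShift (φ : AddChar F ℂ) : ∃ c, ∀ x, φ x = ψ (c * x) := by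
  have hinj := AddChar.to_mulShift_inj_of_isPrimitive hψ
  have hbij : Function.Bijective ψ.mulShift :=
    (Fintype.bijective_iff_injective_and_card _).2 ⟨hinj, AddChar.card_eq.symm⟩
  obtain ⟨c, rfl⟩ := hbij.2 φ
  exact ⟨c, fun x => AddChar.mulShift_apply⟩

/-- `μ` is the linear character `v ↦ ψ (c v_α)`. -/
def HasCoeff (ψ : AddChar F ℂ) (α : PosRoot n) (μ : baseGroup F α →* ℂˣ) (c : F) : Prop :=
  ∀ v : baseGroup F α, ((μ v : ℂˣ) : ℂ) = ψ (c * coord (v : U n F) α)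

include hψ in
-- A member of `BaseChar F α` is determined by its restriction to `X_α`, because the root subgroups
-- outside the arm generate the base group; that restriction is an additive character of `F`.
lemma BaseChar.exists_coeff {α : PosRoot n} (μ : BaseChar F α) :
    ∃ c : Fˣ, HasCoeff ψ α μ.1 c := by
  let r : F → baseGroup F α := fun c => ⟨rootElt α c, rootElt_mem_baseGroup (notMem_arm_self α) c⟩
  let φ : AddChar F ℂ :=
    { toFun := fun c => ((μ.1 (r c) : ℂˣ) : ℂ)
      map_zero_eq_one' := by
        have : r 0 = 1 := Subtype.ext (rootElt_zero α)
        rw [this, map_one, Units.val_one]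
      map_add_eq_mul' := fun c d => by
        have : r (c + d) = r c * r d := Subtype.ext (rootElt_add α c d)
        rw [this, map_mul, Units.val_mul] }
  have hμ : μ.1 = baseHom α φ := by
    -- The locus of equality is pushed into `U n F`, where the base group is a supremum of root
    -- subgroups, so agreement on each of these suffices.
    have hle : baseGroup F α ≤ (μ.1.eqLocus (baseHom α φ)).map (baseGroup F α).subtype := by
      refine iSup₂_le fun β hβ g hg => ?_
      have hmem : g ∈ baseGroup F α := X_le_baseGroup_iff.2 hβ hg
      refine ⟨⟨g, hmem⟩, ?_, rfl⟩
      change μ.1 _ = baseHom α φ _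
      obtain ⟨c, rfl⟩ := mem_X.1 hg
      apply Units.ext
      rw [baseHom_apply, coord_rootElt]
      by_cases h : β = α
      · subst h
        rw [Pi.single_eq_same]
        rfl
      · rw [Pi.single_eq_of_ne (Ne.symm h), AddChar.map_zero_eq_one,
          μ.2.2 β h (X_le_baseGroup_iff.2 hβ) ⟨_, hmem⟩ hg, Units.val_one]
    ext v
    obtain ⟨w, hw, e⟩ := hle v.2
    have : w = v := Subtype.ext e
    subst this
    exact congrArg Units.val hw
  obtain ⟨c, hc⟩ := exists_mulShift hψ φ
  have hcoeff : HasCoeff ψ α μ.1 c := fun v => by rw [hμ, baseHom_apply, hc]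
  have hc0 : c ≠ 0 := by
    rintro rfl
    obtain ⟨v, -, hv⟩ := μ.2.1
    refine hv (Units.ext ?_)
    rw [hcoeff, zero_mul, AddChar.map_zero_eq_one, Units.val_one]
  exact ⟨Units.mk0 c hc0, hcoeff⟩

omit [Fintype F] in
lemma HasCoeff.injective {α : PosRoot n} {μ ν : baseGroup F α →* ℂˣ} {c : F}
    (hμ : HasCoeff ψ α μ c) (hν : HasCoeff ψ α ν c) : μ = ν := by
  ext v
  rw [hμ, hν]

omit [Fintype F] in
include hψ in
lemma exists_ne_one {c : F} (hc : c ≠ 0) : ∃ x, ψ (c * x) ≠ 1 := by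
  have h := hψ hc
  rw [AddChar.ne_one_iff] at h
  simpa [AddChar.mulShift_apply] using h

include hψ in
lemma exists_baseChar (α : PosRoot n) (c : Fˣ) : ∃ μ : BaseChar F α, HasCoeff ψ α μ.1 c := by
  have h0 : HasCoeff ψ α (baseHom α (ψ.mulShift c)) c := fun v => by
    rw [baseHom_apply, AddChar.mulShift_apply]
  refine ⟨⟨baseHom α (ψ.mulShift c), ?_, ?_⟩, h0⟩
  · obtain ⟨x, hx⟩ := exists_ne_one hψ c.ne_zero
    refine ⟨⟨rootElt α x, rootElt_mem_baseGroup (notMem_arm_self α) x⟩, rootElt_mem_X _ _, ?_⟩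
    intro h
    rw [← Units.val_inj, h0, coord_rootElt, Pi.single_eq_same] at h
    exact hx h
  · intro β hβ _ v hv
    obtain ⟨x, hx⟩ := mem_X.1 hv
    apply Units.ext
    rw [h0, hx, coord_rootElt, Pi.single_eq_of_ne (Ne.symm hβ), mul_zero, AddChar.map_zero_eq_one,
      Units.val_one]

include hψ in
lemma HasCoeff.coeff_unique {α : PosRoot n} {μ : baseGroup F α →* ℂˣ} {c d : F}
    (hc : HasCoeff ψ α μ c) (hd : HasCoeff ψ α μ d) : c = d := by
  apply AddChar.to_mulShift_inj_of_isPrimitive hψ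
  ext x
  have h1 := hc ⟨rootElt α x, rootElt_mem_baseGroup (notMem_arm_self α) x⟩
  rw [hd] at h1
  simpa [coord_rootElt, AddChar.mulShift_apply] using h1.symm

/-- The linear characters in `BaseChar F α` are parametrized by the nonzero elements of `F`. -/
def baseCharEquiv (α : PosRoot n) : BaseChar F α ≃ Fˣ where
  toFun μ := (BaseChar.exists_coeff hψ μ).choose
  invFun c := (exists_baseChar hψ α c).choose
  left_inv μ := Subtype.ext ((exists_baseChar hψ α _).choose_spec.injective
    (BaseChar.exists_coeff hψ μ).choose_spec)
  right_inv c := Units.ext ((BaseChar.exists_coeff hψ _).choose_spec.coeff_unique hψ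
    (exists_baseChar hψ α c).choose_spec)

lemma hasCoeff_baseCharEquiv {α : PosRoot n} (μ : BaseChar F α) :
    HasCoeff ψ α μ.1 (baseCharEquiv hψ α μ) :=
  (BaseChar.exists_coeff hψ μ).choose_spec

/-! ### Elementary characters as character sums -/

/-- The part of the row of `α` to the left of `α`. -/
def rowPart (α : PosRoot n) (g : U n F) : Fin n → F := fun k =>
  if k < α.col then val g α.row k else 0

omit [Fintype F] in
lemma between_col (α : PosRoot n) (k : Fin n) :
    k ∈ between α.row α.col ↔ α.row < k ∧ k < α.col := mem_between

lemma rowPart_mem_box (α : PosRoot n) (g : U n F) :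
    rowPart α g ∈ box α.row 1 (between α.row α.col) := by
  rw [mem_box_between]
  refine ⟨?_, fun k hk => ?_⟩
  · rw [rowPart, if_pos α.row_lt_col, val_diag]
  · rw [rowPart]
    rcases hk with hk | hk
    · rw [val_lower g hk, ite_self]
    · rw [if_neg (not_lt.2 (Fin.le_def.2 hk.2))]

/-- The truncated row is a complete invariant of the right coset of the base group. -/
lemma rowPart_eq_iff (α : PosRoot n) (g h : U n F) :
    rowPart α g = rowPart α h ↔ g * h⁻¹ ∈ baseGroup F α := by
  constructor
  · intro e
    have e' : ∀ k, k < α.col → val g α.row k = val h α.row k := by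
      intro k hk
      have := congrFun e k
      simpa [rowPart, hk] using this
    rw [mem_baseGroup]
    intro k h1 h2
    have : val (g * h⁻¹) α.row k = val (h * h⁻¹) α.row k := by
      rw [val_mul, val_mul, Matrix.mul_apply, Matrix.mul_apply]
      refine Finset.sum_congr rfl fun l _ => ?_
      rcases lt_or_ge l α.col with h3 | h3
      · rw [e' l h3]
      · rw [val_lower h⁻¹ (h2.trans_le h3), mul_zero, mul_zero]
    rw [this, mul_inv_cancel, val_one, Matrix.one_apply_ne h1.ne]
  · intro hm
    ext k
    rw [rowPart, rowPart]
    split_ifs with hk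
    · rw [← val_mul_of_mem_baseGroup hm h hk, inv_mul_cancel_right]
    · rfl

omit [Fintype F] in
lemma rowPart_mul (α : PosRoot n) (g h : U n F) {k : Fin n} (hk : k ≤ α.col) :
    val (h * g) α.row k = val h α.row k + (rowPart α h ᵥ* nil g) k := by
  have : val (h * g) = val h + val h * nil g := by
    rw [val_mul, nil, mul_sub, mul_one, add_sub_cancel]
  rw [this, Matrix.add_apply]
  congr 1
  change (val h α.row ᵥ* nil g) k = _
  refine (isStrict_nil g).vecMul_congr fun l hl => ?_
  rw [rowPart, if_pos (hl.trans_le hk)]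

/-- The conjugate lies in the base group when `h * g` and `h` lie in the same right coset, that is,
when right multiplication by `g` fixes the truncated row `x` of `h`; this says that `x (g - 1)`
vanishes there. -/
lemma conj_mem_baseGroup_iff (α : PosRoot n) (g h : U n F) :
    h * g * h⁻¹ ∈ baseGroup F α ↔ rowPart α h ∈ fixRow (nil g) α.row α.col := by
  rw [← rowPart_eq_iff, fixRow, mem_filter]
  simp only [rowPart_mem_box, true_and]
  constructor
  · intro e k hk
    have h2 := ((between_col α k).1 hk).2
    have := congrFun e k
    rw [rowPart, rowPart, if_pos h2, if_pos h2, rowPart_mul α g h h2.le] at this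
    simpa using this
  · intro e
    ext k
    rw [rowPart]
    split_ifs with hk
    · rw [rowPart_mul α g h hk.le, rowPart, if_pos hk]
      rcases lt_or_ge α.row k with h1 | h1
      · rw [e k ((between_col α k).2 ⟨h1, hk⟩), add_zero]
      · rw [(isStrict_nil g).vecMul_eq_zero, add_zero]
        intro l hl
        exact (mem_box_between.1 (rowPart_mem_box α h)).2 l (Or.inl (hl.trans_le h1))
    · rw [rowPart, if_neg hk]

/-- Multiply the conjugate by `h` and compare the entries at `α` of `h * g` and `h`. -/
lemma coord_conj (α : PosRoot n) (g h : U n F) (hm : h * g * h⁻¹ ∈ baseGroup F α) :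
    coord (h * g * h⁻¹) α = (rowPart α h ᵥ* nil g) α.col := by
  have h1 := val_mul_col_of_mem_baseGroup hm h
  rw [inv_mul_cancel_right, rowPart_mul α g h le_rfl, add_comm] at h1
  exact (add_right_cancel h1).symm

/-- The summand of an elementary character belonging to a row vector. -/
def rowTerm (ψ : AddChar F ℂ) (α : PosRoot n) (c : F) (g : U n F) (x : Fin n → F) : ℂ :=
  if x ∈ fixRow (nil g) α.row α.col then ψ (c * (x ᵥ* nil g) α.col) else 0

lemma sum_rowTerm (α : PosRoot n) (c : F) (g : U n F) :
    ∑ x ∈ box α.row 1 (between α.row α.col), rowTerm ψ α c g x =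
      chi ψ (nil g) α.row α.col c := by
  simp only [rowTerm]
  rw [← sum_filter, chi]
  refine sum_congr ?_ fun _ _ => rfl
  ext x
  simp only [fixRow, mem_filter]
  tauto

lemma rowTerm_rowPart (α : PosRoot n) (c : F) (g h : U n F) :
    rowTerm ψ α c g (rowPart α h) =
      if h * g * h⁻¹ ∈ baseGroup F α then ψ (c * coord (h * g * h⁻¹) α) else 0 := by
  rw [rowTerm]
  refine ite_congr (propext (conj_mem_baseGroup_iff α g h).symm) (fun hm => ?_) fun _ => rfl
  rw [coord_conj α g h hm]

lemma rowPart_ofCoord (α : PosRoot n) {x : Fin n → F}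
    (hx : x ∈ box α.row 1 (between α.row α.col)) (v : PosRoot n → F)
    (hv : ∀ β : PosRoot n, β.row = α.row → v β = x β.col) : rowPart α (ofCoord v) = x := by
  rw [mem_box_between] at hx
  ext k
  rw [rowPart]
  split_ifs with hk
  · rcases lt_trichotomy α.row k with h | h | h
    · rw [val_ofCoord_apply _ h]
      exact hv ⟨(α.row, k), h⟩ rfl
    · rw [← h, val_diag, hx.1]
    · rw [val_lower _ h, hx.2 k (Or.inl h)]
  · have hk := not_lt.1 hk
    exact (hx.2 k (Or.inr ⟨α.row_lt_col.trans_le hk, hk⟩)).symm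

/-- The summand of the induced character depends on `h` only through its truncated row, every vector
of the box occurs as such a row, and each occurs as often as the base group has elements. -/
lemma ind_eq_chi {α : PosRoot n} {μ : baseGroup F α →* ℂˣ} {c : F} (hμ : HasCoeff ψ α μ c)
    (g : U n F) : ind μ g = chi ψ (nil g) α.row α.col c := by
  have : Fintype (U n F) := Fintype.ofFinite _
  rw [ind_apply, ← sum_rowTerm]
  have h1 : ∀ h : U n F, (if hm : h * g * h⁻¹ ∈ baseGroup F α then
      ((μ ⟨h * g * h⁻¹, hm⟩ : ℂˣ) : ℂ) else 0) = rowTerm ψ α c g (rowPart α h) := by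
    intro h
    rw [rowTerm_rowPart]
    split_ifs with hm
    · rw [hμ]
    · rfl
  simp only [h1]
  rw [sum_comp_coset (baseGroup F α) _ (rowPart α) (rowPart_eq_iff α) (rowPart_mem_box α)
    (fun x hx => ⟨ofCoord fun β => x β.col, rowPart_ofCoord α hx _ fun _ _ => rfl⟩)]
  rw [inv_mul_cancel_left₀ (by simp)]

end Coordinates

/-! ### Scalar products of products of elementary characters -/

section Orthogonality

open Classical Matrix Finset

variable {n : ℕ} {F : Type*} [Field F] [Fintype F] {ψ : AddChar F ℂ}

/-- The function `g ↦ ψ (∑ M_α g_α)` on `U n F`. -/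
def theta (ψ : AddChar F ℂ) (M : PosRoot n → F) (g : U n F) : ℂ := ψ (∑ p, M p * coord g p)

omit [Fintype F] in
lemma theta_add (M M' : PosRoot n → F) (g : U n F) :
    theta ψ (M + M') g = theta ψ M g * theta ψ M' g := by
  rw [theta, theta, theta, ← AddChar.map_add_eq_mul, ← sum_add_distrib]
  simp only [Pi.add_apply, add_mul]

/-- As a set `U n F` is the vector space of its coordinates, and the functions `theta ψ M` are the
additive characters of that space. They need not be class functions of the group. -/
lemma sum_theta_mul_conj (hψ : ψ.IsPrimitive) [Fintype (U n F)] (M M' : PosRoot n → F) :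
    ∑ g, theta ψ M g * starRingEnd ℂ (theta ψ M' g) =
      if M = M' then (Nat.card (U n F) : ℂ) else 0 := by
  have h1 : ∀ g, theta ψ M g * starRingEnd ℂ (theta ψ M' g) =
      ∏ p, ψ (coord g p * (M p - M' p)) := by
    intro g
    rw [theta, theta, ← AddChar.map_neg_eq_conj, ← AddChar.map_add_eq_mul, ← sub_eq_add_neg,
      ← sum_sub_distrib]
    refine (map_sum ψ.toAddMonoidHom _ _).trans (sum_congr rfl fun p _ => ?_)
    change ψ _ = ψ _
    congr 1
    ring
  have h2 : ∑ g : U n F, ∏ p, ψ (coord g p * (M p - M' p)) =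
      ∑ v : PosRoot n → F, ∏ p, ψ (v p * (M p - M' p)) :=
    Fintype.sum_equiv coordEquiv _ _ fun g => rfl
  rw [sum_congr rfl fun g _ => h1 g, h2, ← Fintype.piFinset_univ,
    ← prod_univ_sum (fun _ => univ) fun p t => ψ (t * (M p - M' p))]
  simp only [sum_mul_char hψ, sub_eq_zero]
  split_ifs with h
  · subst h
    rw [Nat.card_congr (coordEquiv (n := n) (F := F))]
    simp
  · obtain ⟨p, hp⟩ := Function.ne_iff.1 h
    exact prod_eq_zero (mem_univ p) (if_neg hp)

/-- `f` is up to the factor `κ` the sum of the functions `theta ψ (A i)`. -/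
def Expands {ι : Type*} (ψ : AddChar F ℂ) (f : U n F → ℂ) (κ : ℕ) (s : Finset ι)
    (A : ι → PosRoot n → F) : Prop :=
  κ ≠ 0 ∧ ∀ g, (κ : ℂ) * f g = ∑ i ∈ s, theta ψ (A i) g

omit [Fintype F] in
lemma Expands.mul {ι ι' : Type*} {f f' : U n F → ℂ} {κ κ' : ℕ} {s : Finset ι} {s' : Finset ι'}
    {A : ι → PosRoot n → F} {A' : ι' → PosRoot n → F} (h : Expands ψ f κ s A)
    (h' : Expands ψ f' κ' s' A') :
    Expands ψ (f * f') (κ * κ') (s ×ˢ s') (fun i => A i.1 + A' i.2) := by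
  refine ⟨mul_ne_zero h.1 h'.1, fun g => ?_⟩
  rw [Nat.cast_mul, Pi.mul_apply, mul_mul_mul_comm, h.2, h'.2, sum_mul_sum, sum_product]
  simp only [theta_add]

/-- By orthogonality only pairs of terms with equal coefficient families contribute, each with the
same weight. -/
lemma Expands.cip (hψ : ψ.IsPrimitive) {ι ι' : Type*} {f f' : U n F → ℂ} {κ κ' : ℕ} {s : Finset ι}
    {s' : Finset ι'} {A : ι → PosRoot n → F} {A' : ι' → PosRoot n → F} (h : Expands ψ f κ s A)
    (h' : Expands ψ f' κ' s' A') (hinv : ∀ g, f' g⁻¹ = starRingEnd ℂ (f' g)) :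
    (κ : ℂ) * κ' * cip f f' = ((s ×ˢ s').filter fun i => A i.1 = A' i.2).card := by
  have : Fintype (U n F) := Fintype.ofFinite _
  have h1 : ∀ g, (κ : ℂ) * κ' * (f g * f' g⁻¹) =
      ∑ i ∈ s ×ˢ s', theta ψ (A i.1) g * starRingEnd ℂ (theta ψ (A' i.2) g) := by
    intro g
    rw [hinv, mul_mul_mul_comm, h.2, sum_product, ← Complex.conj_natCast, ← map_mul, h'.2, map_sum,
      sum_mul_sum]
  rw [UTri.cip, finsum_eq_sum_of_fintype, mul_left_comm, mul_sum, sum_congr rfl fun g _ => h1 g,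
    sum_comm]
  simp only [sum_theta_mul_conj hψ]
  rw [← sum_filter, sum_const, nsmul_eq_mul, mul_comm, mul_assoc, mul_inv_cancel₀ (by simp), mul_one]

/-- If the `κ * κ` families are distinct, only the diagonal pairs coincide, so the norm is `1`. -/
lemma Expands.cip_self (hψ : ψ.IsPrimitive) {ι : Type*} {f : U n F → ℂ} {κ : ℕ} {s : Finset ι}
    {A : ι → PosRoot n → F} (h : Expands ψ f κ s A) (hinv : ∀ g, f g⁻¹ = starRingEnd ℂ (f g))
    (hs : s.card = κ * κ) (hA : Set.InjOn A s) : UTri.cip f f = 1 := by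
  have h1 := h.cip hψ h hinv
  have h2 : ((s ×ˢ s).filter fun i => A i.1 = A i.2) = s.diag := by
    ext i
    rw [mem_filter, mem_product, mem_diag]
    exact ⟨fun hi => ⟨hi.1.1, hA hi.1.1 hi.1.2 hi.2⟩, fun hi => ⟨⟨hi.1, hi.2 ▸ hi.1⟩, hi.2 ▸ rfl⟩⟩
  have hκ : (κ : ℂ) ≠ 0 := by exact_mod_cast h.1
  rw [h2, diag_card, hs, Nat.cast_mul] at h1
  exact mul_left_cancel₀ (mul_ne_zero hκ hκ) (h1.trans (mul_one _).symm)

lemma Expands.ne (hψ : ψ.IsPrimitive) {ι ι' : Type*} {f f' : U n F → ℂ} {κ κ' : ℕ} {s : Finset ι}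
    {s' : Finset ι'} {A : ι → PosRoot n → F} {A' : ι' → PosRoot n → F} (h : Expands ψ f κ s A)
    (h' : Expands ψ f' κ' s' A') (hinv : ∀ g, f' g⁻¹ = starRingEnd ℂ (f' g))
    (h1 : UTri.cip f f = 1) (hA : ∀ i ∈ s, ∀ j ∈ s', A i ≠ A' j) : f ≠ f' := by
  rintro rfl
  have h2 := h.cip hψ h' hinv
  rw [h1, filter_false_of_mem, card_empty, mul_one, Nat.cast_zero, mul_eq_zero] at h2
  · exact h2.elim (by exact_mod_cast h.1) (by exact_mod_cast h'.1)
  · intro i hi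
    rw [mem_product] at hi
    exact hA _ hi.1 _ hi.2

/-- The invariant `τ` separates the indices with equal families, so each index has at most `q`
partners. -/
lemma Expands.cip_le (hψ : ψ.IsPrimitive) {ι : Type*} {f : U n F → ℂ} {κ : ℕ} {s : Finset ι}
    {A : ι → PosRoot n → F} (h : Expands ψ f κ s A) (hinv : ∀ g, f g⁻¹ = starRingEnd ℂ (f g))
    (hs : s.card = κ * κ) (τ : ι → F)
    (hA : ∀ i ∈ s, ∀ j ∈ s, A i = A j → τ i = τ j → i = j) {k : ℕ} (hk : UTri.cip f f = k) :
    k ≤ Fintype.card F := by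
  have h1 := h.cip hψ h hinv
  have h2 : ((s ×ˢ s).filter fun i => A i.1 = A i.2).card ≤ κ * κ * Fintype.card F := by
    rw [← hs, ← Finset.card_univ, ← card_product]
    refine card_le_card_of_injOn (fun i => (i.1, τ i.2)) (fun i hi => ?_) fun i hi j hj hij => ?_
    · have := mem_filter.1 (mem_coe.1 hi)
      rw [mem_product] at this
      exact mem_coe.2 (mem_product.2 ⟨this.1.1, mem_univ _⟩)
    · have hi := mem_filter.1 (mem_coe.1 hi)
      have hj := mem_filter.1 (mem_coe.1 hj)
      rw [mem_product] at hi hj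
      have e1 : i.1 = j.1 := (Prod.ext_iff.1 hij).1
      have e2 : τ i.2 = τ j.2 := (Prod.ext_iff.1 hij).2
      exact Prod.ext e1 (hA _ hi.1.2 _ hj.1.2 (by rw [← hi.2, e1, hj.2]) e2)
  rw [hk] at h1
  have h3 : κ * κ * k ≤ κ * κ * Fintype.card F := by
    refine le_trans (le_of_eq ?_) h2
    exact_mod_cast h1
  exact Nat.le_of_mul_le_mul_left h3 (Nat.pos_of_ne_zero (mul_ne_zero h.1 h.1))

/-! ### Elementary characters -/

/-- The elementary character at `α` with coefficient `c`. -/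
def elemFun (ψ : AddChar F ℂ) (α : PosRoot n) (c : F) (g : U n F) : ℂ :=
  chi ψ (nil g) α.row α.col c

/-- The pairs of a row vector and a column vector belonging to the hook of `α`. -/
def pairs (F : Type*) [Field F] [Fintype F] (α : PosRoot n) :
    Finset ((Fin n → F) × (Fin n → F)) :=
  box α.row 1 (between α.row α.col) ×ˢ box α.col 1 (between α.row α.col)

/-- The coefficients of the bilinear form `c x N y`. -/
def cross (c : F) (w : (Fin n → F) × (Fin n → F)) (p : PosRoot n) : F := c * w.1 p.row * w.2 p.col

omit [Fintype F] in
lemma theta_cross (c : F) (w : (Fin n → F) × (Fin n → F)) (g : U n F) :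
    ψ (c * (w.1 ⬝ᵥ nil g *ᵥ w.2)) = theta ψ (cross c w) g := by
  rw [theta]
  congr 1
  simp only [dotProduct, mulVec, mul_sum]
  rw [← sum_product', univ_product_univ,
    ← sum_filter_of_ne (p := fun p : Fin n × Fin n => p.1 < p.2)]
  · rw [← sum_subtype_of_mem (p := fun p : Fin n × Fin n => p.1 < p.2)
      (f := fun p : Fin n × Fin n => c * (w.1 p.1 * (nil g p.1 p.2 * w.2 p.2)))]
    · refine sum_congr ?_ fun p _ => ?_
      · ext p
        simpa using p.2
      · change c * (w.1 (PosRoot.row p) * (nil g (PosRoot.row p) (PosRoot.col p) *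
          w.2 (PosRoot.col p))) = _
        rw [nil_apply g (PosRoot.row_lt_col p)]
        simp only [cross, coord]
        ring
    · intro p hp
      exact (mem_filter.1 hp).2
  · intro p _ hp
    by_contra h
    rw [isStrict_nil g _ _ (not_lt.1 h)] at hp
    simp at hp

/-- This is the two-sided formula: `c x N y` is linear in the coordinates of `g`, with coefficients
`cross c (x, y)`. -/
lemma elemFun_expands (hψ : ψ.IsPrimitive) (α : PosRoot n) (c : Fˣ) :
    Expands ψ (elemFun ψ α c) (Fintype.card F ^ (between α.row α.col).card) (pairs F α)
      (cross (c : F)) := by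
  refine ⟨by simp, fun g => ?_⟩
  rw [Nat.cast_pow, elemFun, card_pow_mul_chi hψ _ _ _ c.ne_zero, pairs, sum_product]
  simp only [← theta_cross]

lemma card_pairs (α : PosRoot n) : (pairs F α).card =
    Fintype.card F ^ (between α.row α.col).card * Fintype.card F ^ (between α.row α.col).card := by
  rw [pairs, card_product, card_box (notMem_between_left _ _), card_box (notMem_between_right _ _)]

lemma mem_pairs {α : PosRoot n} {w : (Fin n → F) × (Fin n → F)} :
    w ∈ pairs F α ↔ (w.1 α.row = 1 ∧ ∀ k, k < α.row ∨ α.col ≤ k → w.1 k = 0) ∧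
      (w.2 α.col = 1 ∧ ∀ k, k ≤ α.row ∨ α.col < k → w.2 k = 0) := by
  have hα := α.row_lt_col
  rw [pairs, mem_product, mem_box, mem_box]
  simp only [between_col]
  refine and_congr (and_congr_right fun h1 => ⟨fun h k hk => h k ?_ ?_, fun h k hk h2 => h k ?_⟩)
    (and_congr_right fun h1 => ⟨fun h k hk => h k ?_ ?_, fun h k hk h2 => h k ?_⟩)
  · rintro rfl
    omega
  · omega
  · omega
  · rintro rfl
    omega
  · omega
  · omega

/-- As `x` has entry `1` at the row of `α`, that row of `cross c (x, y)` is `c y`; the extra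
summands cancel there. -/
lemma row_recover {α : PosRoot n} {c : F} (hc : c ≠ 0) {w w' : (Fin n → F) × (Fin n → F)}
    (hw : w ∈ pairs F α) (hw' : w' ∈ pairs F α) {z z' : PosRoot n → F}
    (h : cross c w + z = cross c w' + z') (hz : ∀ p, p.row = α.row → z p = z' p) :
    w.2 = w'.2 := by
  rw [mem_pairs] at hw hw'
  ext k
  rcases le_or_gt k α.row with hk | hk
  · rw [hw.2.2 k (Or.inl hk), hw'.2.2 k (Or.inl hk)]
  · have e := congrFun h ⟨(α.row, k), hk⟩
    rw [Pi.add_apply, Pi.add_apply, hz ⟨(α.row, k), hk⟩ rfl] at e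
    have e2 : c * w.1 α.row * w.2 k = c * w'.1 α.row * w'.2 k := add_right_cancel e
    rw [hw.1.1, hw'.1.1, mul_one] at e2
    exact mul_left_cancel₀ hc e2

lemma col_recover {α : PosRoot n} {c : F} (hc : c ≠ 0) {w w' : (Fin n → F) × (Fin n → F)}
    (hw : w ∈ pairs F α) (hw' : w' ∈ pairs F α) {z z' : PosRoot n → F}
    (h : cross c w + z = cross c w' + z') (hz : ∀ p, p.col = α.col → z p = z' p) :
    w.1 = w'.1 := by
  rw [mem_pairs] at hw hw'
  ext k
  rcases le_or_gt α.col k with hk | hk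
  · rw [hw.1.2 k (Or.inr hk), hw'.1.2 k (Or.inr hk)]
  · have e := congrFun h ⟨(k, α.col), hk⟩
    rw [Pi.add_apply, Pi.add_apply, hz ⟨(k, α.col), hk⟩ rfl] at e
    have e2 : c * w.1 k * w.2 α.col = c * w'.1 k * w'.2 α.col := add_right_cancel e
    rw [hw.2.1, hw'.2.1, mul_one, mul_one] at e2
    exact mul_left_cancel₀ hc e2

lemma cross_injOn {α : PosRoot n} {c : F} (hc : c ≠ 0) : Set.InjOn (cross (n := n) c) (pairs F α) := by
  intro w hw w' hw' h
  have h0 : cross c w + 0 = cross c w' + 0 := by rw [h]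
  exact Prod.ext (col_recover hc hw hw' h0 fun _ _ => rfl) (row_recover hc hw hw' h0 fun _ _ => rfl)

lemma cross_apply_self {α : PosRoot n} {c : F} {w : (Fin n → F) × (Fin n → F)}
    (hw : w ∈ pairs F α) : cross c w α = c := by
  rw [mem_pairs] at hw
  rw [cross, hw.1.1, hw.2.1, mul_one, mul_one]

lemma le_of_cross_ne_zero {α β : PosRoot n} {c : F} {w : (Fin n → F) × (Fin n → F)}
    (hw : w ∈ pairs F α) (h : cross c w β ≠ 0) : α.row ≤ β.row ∧ β.col ≤ α.col := by
  rw [mem_pairs] at hw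
  constructor
  · by_contra h1
    exact h (by rw [cross, hw.1.2 _ (Or.inl (not_le.1 h1)), mul_zero, zero_mul])
  · by_contra h1
    exact h (by rw [cross, hw.2.2 _ (Or.inr (not_le.1 h1)), mul_zero])

/-- The root is the extreme corner, top row and last column, of the support of the family, and the
coefficient is the entry there. -/
lemma root_eq_of_cross_eq {α β : PosRoot n} {c d : F} (hc : c ≠ 0) (hd : d ≠ 0)
    {w w' : (Fin n → F) × (Fin n → F)} (hw : w ∈ pairs F α) (hw' : w' ∈ pairs F β)
    (h : cross c w = cross d w') : α = β ∧ c = d := by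
  have h1 := le_of_cross_ne_zero (c := d) (β := α) hw' (by rwa [← h, cross_apply_self hw])
  have h2 := le_of_cross_ne_zero (c := c) (β := β) hw (by rwa [h, cross_apply_self hw'])
  have e : α = β := PosRoot.ext_iff'.2 ⟨le_antisymm h2.1 h1.1, le_antisymm h1.2 h2.2⟩
  subst e
  exact ⟨rfl, by rw [← cross_apply_self (c := c) hw, h, cross_apply_self hw']⟩

/-- The hook of `β` starts strictly below that of `α` and does not meet the column of `α`. -/
def Below (α β : PosRoot n) : Prop := α.row < β.row ∧ (β.col < α.col ∨ α.col ≤ β.row)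

lemma cross_row_eq_zero {α β : PosRoot n} (h : α.row < β.row) {d : F}
    {w : (Fin n → F) × (Fin n → F)} (hw : w ∈ pairs F β) {p : PosRoot n} (hp : p.row = α.row) :
    cross d w p = 0 := by
  rw [mem_pairs] at hw
  rw [cross, hw.1.2 _ (Or.inl (hp ▸ h)), mul_zero, zero_mul]

lemma Below.cross_col_eq_zero {α β : PosRoot n} (h : Below α β) {d : F}
    {w : (Fin n → F) × (Fin n → F)} (hw : w ∈ pairs F β) {p : PosRoot n} (hp : p.col = α.col) :
    cross d w p = 0 := by
  rw [mem_pairs] at hw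
  rw [cross, hw.2.2 _ (hp ▸ h.2.symm), mul_zero]

/-- The second summand vanishes in the row and the column of `α`, so the first can be read off
there. The alternative `z = 0` serves to compare a product with the elementary character alone. -/
lemma Below.recover {α : PosRoot n} {c : F} (hc : c ≠ 0) {w w' : (Fin n → F) × (Fin n → F)}
    (hw : w ∈ pairs F α) (hw' : w' ∈ pairs F α) {z z' : PosRoot n → F}
    (hz : z = 0 ∨ ∃ β d v, Below α β ∧ v ∈ pairs F β ∧ z = cross d v)
    (hz' : z' = 0 ∨ ∃ β d v, Below α β ∧ v ∈ pairs F β ∧ z' = cross d v)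
    (h : cross c w + z = cross c w' + z') : w = w' ∧ z = z' := by
  have hrow : ∀ z : PosRoot n → F, (z = 0 ∨ ∃ β d v, Below α β ∧ v ∈ pairs F β ∧ z = cross d v) →
      ∀ p, p.row = α.row → z p = 0 := by
    rintro z (rfl | ⟨β, d, v, hb, hv, rfl⟩) p hp
    · rfl
    · exact cross_row_eq_zero hb.1 hv hp
  have hcol : ∀ z : PosRoot n → F, (z = 0 ∨ ∃ β d v, Below α β ∧ v ∈ pairs F β ∧ z = cross d v) →
      ∀ p, p.col = α.col → z p = 0 := by
    rintro z (rfl | ⟨β, d, v, hb, hv, rfl⟩) p hp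
    · rfl
    · exact hb.cross_col_eq_zero hv hp
  have e : w = w' := Prod.ext
    (col_recover hc hw hw' h fun p hp => by rw [hcol z hz p hp, hcol z' hz' p hp])
    (row_recover hc hw hw' h fun p hp => by rw [hrow z hz p hp, hrow z' hz' p hp])
  subst e
  exact ⟨rfl, add_left_cancel h⟩

variable (hψ : ψ.IsPrimitive)
include hψ

lemma elem_eq_elemFun {α : PosRoot n} (μ : BaseChar F α) :
    elem μ = elemFun ψ α (baseCharEquiv hψ α μ) :=
  funext fun g => ind_eq_chi (hasCoeff_baseCharEquiv hψ μ) g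

lemma exists_elem (α : PosRoot n) (c : Fˣ) : ∃ μ : BaseChar F α, elem μ = elemFun ψ α c :=
  ⟨(baseCharEquiv hψ α).symm c, by rw [elem_eq_elemFun hψ, Equiv.apply_symm_apply]⟩

lemma isChar_elemFun (α : PosRoot n) (c : Fˣ) : IsChar (elemFun ψ α c) := by
  obtain ⟨μ, h⟩ := exists_elem hψ α c
  exact h ▸ isChar_ind _

lemma elemFun_inv (α : PosRoot n) (c : Fˣ) (g : U n F) :
    elemFun ψ α c g⁻¹ = starRingEnd ℂ (elemFun ψ α c g) := by
  obtain ⟨μ, h⟩ := exists_elem hψ α c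
  rw [← h]
  exact ind_inv _ g

omit hψ in
lemma elemFun_one (α : PosRoot n) (c : F) :
    elemFun ψ α c 1 = (Fintype.card F : ℂ) ^ (between α.row α.col).card := by
  have h0 : nil (1 : U n F) = 0 := by rw [nil, val_one, sub_self]
  rw [elemFun, chi, h0, fixRow, filter_true_of_mem (fun x _ k _ => by simp)]
  simp [card_box (notMem_between_left _ _)]

lemma mul_elemFun_inv (α β : PosRoot n) (c d : Fˣ) (g : U n F) :
    (elemFun ψ α c * elemFun ψ β d) g⁻¹ =
      starRingEnd ℂ ((elemFun ψ α c * elemFun ψ β d) g) := by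
  rw [Pi.mul_apply, Pi.mul_apply, map_mul, elemFun_inv hψ, elemFun_inv hψ]

lemma mul_elemFun_expands (α β : PosRoot n) (c d : Fˣ) :
    Expands ψ (elemFun ψ α c * elemFun ψ β d)
      (Fintype.card F ^ (between α.row α.col).card * Fintype.card F ^ (between β.row β.col).card)
      (pairs F α ×ˢ pairs F β) fun i => cross (c : F) i.1 + cross (d : F) i.2 :=
  (elemFun_expands hψ α c).mul (elemFun_expands hψ β d)

omit hψ in
lemma card_pairs_product (α β : PosRoot n) : (pairs F α ×ˢ pairs F β).card =
    (Fintype.card F ^ (between α.row α.col).card * Fintype.card F ^ (between β.row β.col).card) *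
    (Fintype.card F ^ (between α.row α.col).card *
      Fintype.card F ^ (between β.row β.col).card) := by
  rw [card_product, card_pairs, card_pairs]
  ring

lemma cip_elemFun (α : PosRoot n) (c : Fˣ) : cip (elemFun ψ α c) (elemFun ψ α c) = 1 :=
  (elemFun_expands hψ α c).cip_self hψ (elemFun_inv hψ α c) (card_pairs α) (cross_injOn c.ne_zero)

lemma cip_mul_elemFun {α β : PosRoot n} (h : Below α β) (c d : Fˣ) :
    cip (elemFun ψ α c * elemFun ψ β d) (elemFun ψ α c * elemFun ψ β d) = 1 := by
  refine (mul_elemFun_expands hψ α β c d).cip_self hψ (mul_elemFun_inv hψ α β c d)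
    (card_pairs_product α β) ?_
  rintro ⟨w, v⟩ hw ⟨w', v'⟩ hw' e
  rw [mem_coe, mem_product] at hw hw'
  obtain ⟨e1, e2⟩ := Below.recover c.ne_zero hw.1 hw'.1 (Or.inr ⟨β, d, v, h, hw.2, rfl⟩)
    (Or.inr ⟨β, d, v', h, hw'.2, rfl⟩) e
  exact Prod.ext e1 (cross_injOn d.ne_zero hw.2 hw'.2 e2)

lemma isIrr_elemFun (α : PosRoot n) (c : Fˣ) : IsIrr (elemFun ψ α c) :=
  (isChar_elemFun hψ α c).isIrr (cip_elemFun hψ α c)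

lemma isIrr_mul_elemFun {α β : PosRoot n} (h : Below α β) (c d : Fˣ) :
    IsIrr (elemFun ψ α c * elemFun ψ β d) :=
  ((isChar_elemFun hψ α c).mul (isChar_elemFun hψ β d)).isIrr (cip_mul_elemFun hψ h c d)

lemma elemFun_ne_mul {α β : PosRoot n} (h : Below α β) (c d : Fˣ) :
    elemFun ψ α c ≠ elemFun ψ α c * elemFun ψ β d := by
  refine (elemFun_expands hψ α c).ne hψ (mul_elemFun_expands hψ α β c d)
    (mul_elemFun_inv hψ α β c d) (cip_elemFun hψ α c) ?_
  rintro w hw ⟨w', v⟩ hw' e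
  rw [mem_product] at hw'
  rw [← add_zero (cross (c : F) w)] at e
  obtain ⟨-, e2⟩ := Below.recover c.ne_zero hw hw'.1 (Or.inl rfl)
    (Or.inr ⟨β, d, v, h, hw'.2, rfl⟩) e
  have e3 := congrFun e2 β
  rw [cross_apply_self hw'.2] at e3
  exact d.ne_zero e3.symm

lemma eq_of_mul_elemFun_eq {α β γ : PosRoot n} (hβ : Below α β) (hγ : Below α γ) (c d e : Fˣ)
    (h : elemFun ψ α c * elemFun ψ β d = elemFun ψ α c * elemFun ψ γ e) : β = γ ∧ d = e := by
  by_contra hne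
  refine (mul_elemFun_expands hψ α β c d).ne hψ (mul_elemFun_expands hψ α γ c e)
    (mul_elemFun_inv hψ α γ c e) (cip_mul_elemFun hψ hβ c d) ?_ h
  rintro ⟨w, v⟩ hw ⟨w', v'⟩ hw' e1
  rw [mem_product] at hw hw'
  obtain ⟨-, e2⟩ := Below.recover c.ne_zero hw.1 hw'.1 (Or.inr ⟨β, d, v, hβ, hw.2, rfl⟩)
    (Or.inr ⟨γ, e, v', hγ, hw'.2, rfl⟩) e1
  obtain ⟨e3, e4⟩ := root_eq_of_cross_eq d.ne_zero e.ne_zero hw.2 hw'.2 e2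
  exact hne ⟨e3, Units.ext e4⟩

/-- The hooks of `α` and `β` cross, that of `α` starting above. -/
def Crossing (α β : PosRoot n) : Prop := α.row < β.row ∧ β.row < α.col ∧ α.col < β.col

/-- The row of `α` is free of the second family and the column of `β` is free of the first, which
gives `w.2` and `v.1`. In the column of `α` the second family still contributes, but only through
the number `v.2 α.col`; once this is known, `w.1` and then `v` follow. That number is the parameter
`τ`. -/
lemma Crossing.cip_le {α β : PosRoot n} (h : Crossing α β) (c d : Fˣ) {k : ℕ}
    (hk : cip (elemFun ψ α c * elemFun ψ β d) (elemFun ψ α c * elemFun ψ β d) = k) :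
    k ≤ Fintype.card F := by
  refine (mul_elemFun_expands hψ α β c d).cip_le hψ (mul_elemFun_inv hψ α β c d)
    (card_pairs_product α β) (fun i => i.2.2 α.col) ?_ hk
  rintro ⟨w, v⟩ hw ⟨w', v'⟩ hw' e hτ
  rw [mem_product] at hw hw'
  have hcol : ∀ w : (Fin n → F) × (Fin n → F), w ∈ pairs F α → ∀ p : PosRoot n, p.col = β.col →
      cross (c : F) w p = 0 := by
    intro w hw p hp
    rw [mem_pairs] at hw
    rw [cross, hw.2.2 _ (Or.inr (hp ▸ h.2.2)), mul_zero]
  have e1 : w.2 = w'.2 := row_recover c.ne_zero hw.1 hw'.1 e fun p hp => by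
    rw [cross_row_eq_zero h.1 hw.2 hp, cross_row_eq_zero h.1 hw'.2 hp]
  have e2 : v.1 = v'.1 := by
    refine col_recover d.ne_zero hw.2 hw'.2 (z := cross (c : F) w) (z' := cross (c : F) w') ?_
      fun p hp => by rw [hcol _ hw.1 p hp, hcol _ hw'.1 p hp]
    rw [add_comm, add_comm (cross (d : F) v')]
    exact e
  have e3 : w.1 = w'.1 := col_recover c.ne_zero hw.1 hw'.1 e fun p hp => by
    change v.2 α.col = v'.2 α.col at hτ
    rw [cross, cross, e2, hp, hτ]
  have e4 : w = w' := Prod.ext e3 e1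
  subst e4
  exact Prod.ext rfl (cross_injOn d.ne_zero hw.2 hw'.2 (add_left_cancel e))

end Orthogonality

/-! ### Products of elementary characters with crossing hooks -/

section CrossingHooks

open Classical Matrix Finset

variable {n : ℕ} {F : Type*} [Field F] [Fintype F] {ψ : AddChar F ℂ} {α β : PosRoot n}

namespace Crossing

/-- The root at the row of `α` and in the column whose index is the row of `β`. -/
def corner (h : Crossing α β) : PosRoot n := ⟨(α.row, β.row), h.1⟩

/-- The roots outside the arms of `α` and `β`, together with the corner. -/
def roots (h : Crossing α β) : Set (PosRoot n) := {p | (p ∈ α.arm → p = h.corner) ∧ p ∉ β.arm}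

/-- A sum lying in the arm of `α` would have the corner as first summand; the second would then
start in the row of `β` and end before the column of `α`, so it would lie in the arm of `β`, which
is excluded. -/
lemma isClosedRoots (h : Crossing α β) : IsClosedRoots h.roots := by
  intro r s t h1 h2 ⟨hrs, hrs'⟩ ⟨hst, hst'⟩
  simp only [PosRoot.mem_arm] at hrs hrs' hst hst'
  refine ⟨fun hrt => ?_, fun hrt => ?_⟩
  · rw [PosRoot.mem_arm] at hrt
    have e := hrs ⟨hrt.1, h2.trans hrt.2⟩
    have e2 : s = β.row := congrArg PosRoot.col e
    exact absurd ⟨e2, lt_trans hrt.2 h.2.2⟩ hst'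
  · rw [PosRoot.mem_arm] at hrt
    exact hrs' ⟨hrt.1, h2.trans hrt.2⟩

/-- The subgroup from which the constituents of the product are induced. -/
def subgroup (F : Type*) [Field F] [Finite F] (h : Crossing α β) : Subgroup (U n F) :=
  pattern F h.roots h.isClosedRoots

lemma mem_subgroup (h : Crossing α β) {g : U n F} : g ∈ h.subgroup F ↔
    (∀ k, α.row < k → k < α.col → k ≠ β.row → val g α.row k = 0) ∧ g ∈ baseGroup F β := by
  rw [subgroup, mem_pattern, mem_baseGroup]
  constructor
  · intro hg
    refine ⟨fun k h1 h2 h3 => hg ⟨(α.row, k), h1⟩ fun hk => h3 ?_,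
      fun k h1 h2 => hg ⟨(β.row, k), h1⟩ fun hk => hk.2 (PosRoot.mem_arm.2 ⟨rfl, h2⟩)⟩
    exact congrArg PosRoot.col (hk.1 (PosRoot.mem_arm.2 ⟨rfl, h2⟩))
  · rintro ⟨hg1, hg2⟩ p hp
    by_cases h1 : p ∈ β.arm
    · rw [PosRoot.mem_arm] at h1
      have := hg2 p.col (h1.1 ▸ p.row_lt_col) h1.2
      rwa [← h1.1] at this
    · have h2 : p ∈ α.arm ∧ p ≠ h.corner := by
        by_contra h3
        exact hp ⟨fun h4 => by_contra fun h5 => h3 ⟨h4, h5⟩, h1⟩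
      obtain ⟨h2, h3⟩ := h2
      rw [PosRoot.mem_arm] at h2
      have := hg1 p.col (h2.1 ▸ p.row_lt_col) h2.2 fun h4 => h3 (PosRoot.ext_iff'.2 ⟨h2.1, h4⟩)
      rwa [← h2.1] at this

/-- The arm of the corner is part of the arm of `α` and does not contain the corner. This makes the
coordinate at the corner additive on the subgroup. -/
lemma mem_baseGroup_corner (h : Crossing α β) {g : U n F} (hg : g ∈ h.subgroup F) :
    g ∈ baseGroup F h.corner := by
  rw [mem_baseGroup]
  intro k h1 h2
  exact (h.mem_subgroup.1 hg).1 k h1 (lt_trans h2 h.2.1) (ne_of_lt h2)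

lemma coord_corner_mul (h : Crossing α β) {v w : U n F} (hv : v ∈ h.subgroup F) :
    coord (v * w) h.corner = coord v h.corner + coord w h.corner :=
  val_mul_col_of_mem_baseGroup (h.mem_baseGroup_corner hv) w

lemma coord_mul_right (h : Crossing α β) {v w : U n F} (hv : v ∈ h.subgroup F) :
    coord (v * w) β = coord v β + coord w β :=
  val_mul_col_of_mem_baseGroup (h.mem_subgroup.1 hv).2 w

/-- Allowing the corner to be nonzero adds a single term to the product, and its second factor is
the entry of `w` at `(β.row, α.col)`, which vanishes because this position lies in the arm of `β`.
-/
lemma coord_mul_left (h : Crossing α β) {v w : U n F} (hv : v ∈ h.subgroup F)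
    (hw : w ∈ h.subgroup F) : coord (v * w) α = coord v α + coord w α := by
  have hw0 : val w β.row α.col = 0 :=
    mem_baseGroup.1 (h.mem_subgroup.1 hw).2 α.col h.2.1 h.2.2
  change val (v * w) α.row α.col = val v α.row α.col + val w α.row α.col
  rw [val_mul, Matrix.mul_apply, ← Finset.sum_subset (Finset.subset_univ {α.row, α.col}),
    Finset.sum_pair α.row_lt_col.ne, val_diag, val_diag, one_mul, mul_one, add_comm]
  intro l _ hl
  simp only [mem_insert, mem_singleton, not_or] at hl
  by_cases hl2 : l = β.row
  · rw [hl2, hw0, mul_zero]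
  rcases lt_or_gt_of_ne hl.1 with h1 | h1
  · rw [val_lower v h1, zero_mul]
  · rcases lt_or_gt_of_ne hl.2 with h2 | h2
    · rw [(h.mem_subgroup.1 hv).1 l h1 h2 hl2, zero_mul]
    · rw [val_lower w h2, mul_zero]

/-- The linear character `w ↦ ψ (c w_α + d w_β + u w_γ)`, `γ` the corner. -/
def hom (h : Crossing α β) (ψ : AddChar F ℂ) (c d u : F) : h.subgroup F →* ℂˣ :=
  MonoidHom.toHomUnits
    { toFun := fun w => ψ (c * coord (w : U n F) α) * ψ (d * coord (w : U n F) β) *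
        ψ (u * coord (w : U n F) h.corner)
      map_one' := by
        have h1 : ∀ p : PosRoot n, coord (1 : U n F) p = 0 := fun p => by
          rw [← rootElt_zero p, coord_rootElt, Pi.single_eq_same]
        simp [h1]
      map_mul' := fun v w => by
        rw [Subgroup.coe_mul, h.coord_mul_left v.2 w.2, h.coord_mul_right v.2,
          h.coord_corner_mul v.2]
        simp only [mul_add, AddChar.map_add_eq_mul]
        ring }

lemma hom_apply (h : Crossing α β) (c d u : F) (w : h.subgroup F) :
    ((h.hom ψ c d u w : ℂˣ) : ℂ) = ψ (c * coord (w : U n F) α) * ψ (d * coord (w : U n F) β) *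
        ψ (u * coord (w : U n F) h.corner) := rfl

lemma mem_inf_iff (h : Crossing α β) {g : U n F} : g ∈ baseGroup F α ⊓ baseGroup F β ↔
    g ∈ h.subgroup F ∧ coord g h.corner = 0 := by
  rw [Subgroup.mem_inf, h.mem_subgroup, mem_baseGroup]
  constructor
  · rintro ⟨h1, h2⟩
    exact ⟨⟨fun k hk hk' _ => h1 k hk hk', h2⟩, h1 β.row h.1 h.2.1⟩
  · rintro ⟨⟨h1, h2⟩, h3⟩
    refine ⟨fun k hk hk' => ?_, h2⟩
    by_cases hkb : k = β.row
    · rw [hkb]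
      exact h3
    · exact h1 k hk hk' hkb

/-- The intersection of the two base groups is the kernel of the coordinate at the corner, a
homomorphism onto `F`. -/
lemma card_subgroup (h : Crossing α β) : (Nat.card (h.subgroup F) : ℂ) =
    Nat.card ↥(baseGroup F α ⊓ baseGroup F β) * Fintype.card F := by
  have : Fintype (h.subgroup F) := Fintype.ofFinite _
  have hle : baseGroup F α ⊓ baseGroup F β ≤ h.subgroup F := fun g hg => (h.mem_inf_iff.1 hg).1
  have := sum_comp_coset ((baseGroup F α ⊓ baseGroup F β).subgroupOf (h.subgroup F)) univ
    (fun w : h.subgroup F => coord (w : U n F) h.corner) (fun v w => ?_) (fun _ => mem_univ _)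
    (fun x _ => ⟨⟨rootElt h.corner x, ?_⟩, ?_⟩) (fun _ => 1)
  · rw [Nat.card_congr (Subgroup.subgroupOfEquivOfLe hle).toEquiv] at this
    simpa using this
  · rw [Subgroup.mem_subgroupOf, h.mem_inf_iff]
    have e := h.coord_corner_mul (v := (v : U n F) * (w : U n F)⁻¹) (w := w) (v * w⁻¹).2
    rw [inv_mul_cancel_right] at e
    have hm : ((v * w⁻¹ : h.subgroup F) : U n F) = (v : U n F) * (w : U n F)⁻¹ := rfl
    rw [hm, e]
    constructor
    · intro e2
      exact ⟨(v * w⁻¹).2, add_eq_right.1 e2⟩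
    · rintro ⟨-, e2⟩
      rw [e2, zero_add]
  · refine h.mem_subgroup.2 ⟨fun k h1 h2 h3 => ?_, rootElt_mem_baseGroup ?_ x⟩
    · have : coord (rootElt h.corner x) ⟨(α.row, k), h1⟩ = 0 := by
        rw [coord_rootElt, Pi.single_eq_of_ne]
        intro e
        exact h3 (congrArg PosRoot.col e)
      exact this
    · rw [PosRoot.mem_arm]
      rintro ⟨e, -⟩
      exact h.1.ne e
  · change coord (rootElt h.corner x) h.corner = x
    rw [coord_rootElt, Pi.single_eq_same]

variable (hψ : ψ.IsPrimitive)
include hψ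

/-- Summing `ψ (u * w_γ)` over `u`, with `γ` the corner, gives `q` times the indicator of the
intersection of the base groups. There the linear character is the product of the two given ones,
and the factor `q` is the index of the intersection. -/
lemma sum_ind (h : Crossing α β) (c d : F) :
    ∑ u, ind (h.hom ψ c d u) = elemFun ψ α c * elemFun ψ β d := by
  have : Fintype (U n F) := Fintype.ofFinite _
  ext g
  rw [Finset.sum_apply]
  simp only [ind_apply]
  rw [← mul_sum, sum_comm]
  have h1 : ∀ x : U n F, ∑ u, (if hm : x * g * x⁻¹ ∈ h.subgroup F then
      ((h.hom ψ c d u ⟨x * g * x⁻¹, hm⟩ : ℂˣ) : ℂ) else 0) =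
      Fintype.card F * (rowTerm ψ α c g (rowPart α x) * rowTerm ψ β d g (rowPart β x)) := by
    intro x
    rw [rowTerm_rowPart, rowTerm_rowPart]
    by_cases hm : x * g * x⁻¹ ∈ h.subgroup F
    · simp only [dif_pos hm, hom_apply]
      rw [← mul_sum, sum_mul_char hψ]
      by_cases h0 : coord (x * g * x⁻¹) h.corner = 0
      · have h2 := Subgroup.mem_inf.1 (h.mem_inf_iff.2 ⟨hm, h0⟩)
        rw [if_pos h0, if_pos h2.1, if_pos h2.2, mul_comm]
      · have h2 : x * g * x⁻¹ ∉ baseGroup F α := fun h3 =>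
          h0 (h.mem_inf_iff.1 ⟨h3, (h.mem_subgroup.1 hm).2⟩).2
        rw [if_neg h0, if_neg h2, mul_zero, zero_mul, mul_zero]
    · simp only [dif_neg hm, sum_const_zero]
      by_cases h2 : x * g * x⁻¹ ∈ baseGroup F α
      · have h3 : x * g * x⁻¹ ∉ baseGroup F β := fun h3 => hm (h.mem_inf_iff.1 ⟨h2, h3⟩).1
        rw [if_neg h3, mul_zero, mul_zero]
      · rw [if_neg h2, zero_mul, mul_zero]
  -- The roots lie in different rows, so the two truncated rows can be prescribed independently:
  -- pairs of row vectors parametrize the cosets of the intersection.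
  have h2 := sum_comp_coset (baseGroup F α ⊓ baseGroup F β)
    (box α.row 1 (between α.row α.col) ×ˢ box β.row 1 (between β.row β.col))
    (fun x => (rowPart α x, rowPart β x))
    (fun x y => by rw [Prod.mk.injEq, rowPart_eq_iff, rowPart_eq_iff, Subgroup.mem_inf])
    (fun x => mem_product.2 ⟨rowPart_mem_box α x, rowPart_mem_box β x⟩)
    (fun w hw => by
      rw [mem_product] at hw
      refine ⟨ofCoord fun p => if p.row = α.row then w.1 p.col else w.2 p.col,
        Prod.ext (rowPart_ofCoord α hw.1 _ fun p hp => if_pos hp)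
          (rowPart_ofCoord β hw.2 _ fun p hp => if_neg ?_)⟩
      rw [hp]
      exact h.1.ne')
    (fun w => rowTerm ψ α c g w.1 * rowTerm ψ β d g w.2)
  rw [sum_product, ← sum_mul_sum, sum_rowTerm, sum_rowTerm] at h2
  rw [sum_congr rfl fun x _ => h1 x, ← mul_sum, h2, h.card_subgroup, ← mul_assoc (Fintype.card F : ℂ),
    mul_comm (Fintype.card F : ℂ), inv_mul_cancel_left₀]
  · rfl
  · exact mul_ne_zero (Nat.cast_ne_zero.2 Nat.card_pos.ne') (by simp)

omit hψ in
lemma ind_one {G : Type*} [Group G] [Finite G] {H : Subgroup G} (μ : H →* ℂˣ) :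
    ind μ 1 = (Nat.card H : ℂ)⁻¹ * Nat.card G := by
  have : Fintype G := Fintype.ofFinite G
  rw [ind_apply]
  congr 1
  have h1 : ∀ x : G, (if hm : x * 1 * x⁻¹ ∈ H then ((μ ⟨x * 1 * x⁻¹, hm⟩ : ℂˣ) : ℂ) else 0) = 1 := by
    intro x
    have e : x * 1 * x⁻¹ = 1 := by group
    have hm : x * 1 * x⁻¹ ∈ H := by rw [e]; exact H.one_mem
    rw [dif_pos hm]
    have e2 : (⟨x * 1 * x⁻¹, hm⟩ : H) = 1 := Subtype.ext e
    rw [e2, map_one, Units.val_one]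
  rw [sum_congr rfl fun x _ => h1 x]
  simp

/-- A product of norm at most `q` is written as a sum of `q` characters, so there is no room for
coincidences or reducible summands. -/
lemma decomposes (h : Crossing α β) (c d : Fˣ) :
    (∀ u, IsIrr (ind (h.hom ψ c d u))) ∧ Function.Injective fun u => ind (h.hom ψ c d u) := by
  obtain ⟨k, hk⟩ := ((isChar_elemFun hψ α c).mul (isChar_elemFun hψ β d)).cip_nat
    ((isChar_elemFun hψ α c).mul (isChar_elemFun hψ β d))
  refine irr_of_cip_sum_le _ (fun u => isChar_ind _) (fun u => ?_) k (h.cip_le hψ c d hk) ?_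
  · rw [ind_one]
    exact mul_ne_zero (by simp) (by simp)
  · rw [h.sum_ind hψ, hk]

omit hψ in
lemma card_between_pos (h : Crossing α β) : 0 < (between α.row α.col).card :=
  card_pos.2 ⟨β.row, mem_between.2 ⟨h.1, h.2.1⟩⟩

/-- All `q` characters are induced from the same subgroup, so each has the degree of the product
divided by `q`. -/
lemma degree (h : Crossing α β) (c d u : F) : ind (h.hom ψ c d u) 1 =
    (Fintype.card F : ℂ) ^
      ((between α.row α.col).card + (between β.row β.col).card - 1) := by
  have h1 := congrFun (h.sum_ind hψ c d) 1
  rw [Finset.sum_apply, Pi.mul_apply, elemFun_one, elemFun_one] at h1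
  simp only [ind_one] at h1
  rw [sum_const, card_univ, nsmul_eq_mul, ← pow_add] at h1
  rw [ind_one]
  have hq : (Fintype.card F : ℂ) ≠ 0 := by simp
  refine mul_left_cancel₀ hq ?_
  rw [h1, ← pow_succ', Nat.sub_add_cancel]
  have := h.card_between_pos
  omega

end Crossing

end CrossingHooks

/-! ### Intersections of hooks -/

section Hooks

open Classical Matrix Finset

variable {n : ℕ} {F : Type*} [Field F] {α β : PosRoot n}

lemma PosRoot.mem_hook {p : PosRoot n} : p ∈ α.hook ↔
    (p.row = α.row ∧ p.col ≤ α.col) ∨ (p.col = α.col ∧ α.row ≤ p.row) := by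
  rw [hook, mem_union, mem_union, mem_singleton, mem_arm, mem_leg, ext_iff']
  constructor
  · rintro ((⟨h1, h2⟩ | ⟨h1, h2⟩) | ⟨h1, h2⟩)
    · exact Or.inl ⟨h1, h2.le⟩
    · exact Or.inl ⟨h1, h2.le⟩
    · exact Or.inr ⟨h1, h2.le⟩
  · rintro (⟨h1, h2⟩ | ⟨h1, h2⟩)
    · exact Or.inl (h2.lt_or_eq.elim (fun h => Or.inr ⟨h1, h⟩) fun h => Or.inl ⟨h1, h⟩)
    · exact h2.lt_or_eq.elim (fun h => Or.inr ⟨h1, h⟩) fun h => Or.inl (Or.inl ⟨h.symm, h1⟩)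

lemma isClosedRoots_hook (α : PosRoot n) : IsClosedRoots {p | p ∈ α.hook} := by
  intro r s t h1 h2 hrs hst
  rw [Set.mem_ofPred_eq, PosRoot.mem_hook] at *
  change (r = α.row ∧ s ≤ α.col) ∨ (s = α.col ∧ α.row ≤ r) at hrs
  change (s = α.row ∧ t ≤ α.col) ∨ (t = α.col ∧ α.row ≤ s) at hst
  change (r = α.row ∧ t ≤ α.col) ∨ (t = α.col ∧ α.row ≤ r)
  omega

/-- Hooks are closed under addition of roots, so hook groups are pattern groups, and their
intersection is cut out by the coordinates outside the common roots. -/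
lemma card_hookGroup_inf [Finite F] (α β : PosRoot n) :
    Nat.card ↥(hookGroup F α ⊓ hookGroup F β) = Nat.card F ^ (α.hook ∩ β.hook).card := by
  have := Fintype.ofFinite F
  have h1 : ∀ g : U n F, g ∈ hookGroup F α ⊓ hookGroup F β ↔ coord g ∈
      Fintype.piFinset fun p => if p ∈ α.hook ∩ β.hook then (univ : Finset F) else {0} := by
    intro g
    rw [Subgroup.mem_inf, hookGroup, hookGroup, mem_gen (isClosedRoots_hook α),
      mem_gen (isClosedRoots_hook β), Fintype.mem_piFinset]
    constructor
    · rintro ⟨h2, h3⟩ p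
      split_ifs with h4
      · exact mem_univ _
      · rw [mem_singleton]
        by_cases h5 : p ∈ α.hook
        · exact h3 p fun h6 => h4 (mem_inter.2 ⟨h5, h6⟩)
        · exact h2 p h5
    · intro h2
      refine ⟨fun p hp => ?_, fun p hp => ?_⟩
      · have := h2 p
        rwa [if_neg fun h => hp (mem_inter.1 h).1, mem_singleton] at this
      · have := h2 p
        rwa [if_neg fun h => hp (mem_inter.1 h).2, mem_singleton] at this
  rw [Nat.card_congr (coordEquiv.subtypeEquiv h1), Nat.card_eq_finsetCard, Fintype.card_piFinset,
    Nat.card_eq_fintype_card]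
  have h2 : ∀ p, (if p ∈ α.hook ∩ β.hook then univ else {0} : Finset F).card =
      if p ∈ α.hook ∩ β.hook then Fintype.card F else 1 := by
    intro p
    split_ifs <;> simp
  rw [prod_congr rfl fun p _ => h2 p, prod_ite_mem, univ_inter, prod_const]

lemma Below.hook_inter (h : Below α β) : α.hook ∩ β.hook = ∅ := by
  ext p
  have hp := p.row_lt_col
  have hα := α.row_lt_col
  have hβ := β.row_lt_col
  obtain ⟨h1, h2⟩ := h
  rw [mem_inter, PosRoot.mem_hook, PosRoot.mem_hook]
  simp only [notMem_empty, iff_false]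
  omega

/-- The common position lies in the leg of `α` and the arm of `β`; it is not the root
`Crossing.corner`. -/
lemma Crossing.card_hook_inter (h : Crossing α β) : (α.hook ∩ β.hook).card = 1 := by
  obtain ⟨h1, h2, h3⟩ := h
  rw [card_eq_one]
  refine ⟨⟨(β.row, α.col), h2⟩, ?_⟩
  ext p
  have hp := p.row_lt_col
  rw [mem_inter, PosRoot.mem_hook, PosRoot.mem_hook, mem_singleton, PosRoot.ext_iff']
  change _ ↔ p.row = β.row ∧ p.col = α.col
  omega

/-- Hooks with a common row or column share the two positions in it nearest to the diagonal; the
inequalities on lengths ensure that both hooks reach them. -/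
lemma one_lt_card_hook_inter (hα : (α.row : ℕ) + 1 < α.col) (hβ : (β.row : ℕ) + 1 < β.col)
    (h : α.row = β.row ∨ α.col = β.col) : 1 < (α.hook ∩ β.hook).card := by
  rw [one_lt_card]
  have h1 := α.col.2
  have h2 := β.col.2
  rcases h with h | h
  · refine ⟨⟨(α.row, ⟨α.row + 1, by omega⟩), Nat.lt_succ_self _⟩, ?_,
      ⟨(α.row, ⟨α.row + 2, by omega⟩), Nat.lt_succ_of_lt (Nat.lt_succ_self _)⟩, ?_, fun e => ?_⟩
    · rw [mem_inter, PosRoot.mem_hook, PosRoot.mem_hook]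
      refine ⟨Or.inl ⟨rfl, ?_⟩, Or.inl ⟨h, ?_⟩⟩
      · change (α.row : ℕ) + 1 ≤ α.col
        omega
      · change (α.row : ℕ) + 1 ≤ β.col
        omega
    · rw [mem_inter, PosRoot.mem_hook, PosRoot.mem_hook]
      refine ⟨Or.inl ⟨rfl, ?_⟩, Or.inl ⟨h, ?_⟩⟩
      · change (α.row : ℕ) + 2 ≤ α.col
        omega
      · change (α.row : ℕ) + 2 ≤ β.col
        omega
    · have : (α.row : ℕ) + 1 = α.row + 2 :=
        congrArg (fun p : PosRoot n => ((PosRoot.col p : Fin n) : ℕ)) e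
      omega
  · refine ⟨⟨(⟨α.col - 1, by omega⟩, α.col), ?_⟩, ?_, ⟨(⟨α.col - 2, by omega⟩, α.col), ?_⟩, ?_,
      fun e => ?_⟩
    · change (α.col : ℕ) - 1 < α.col
      omega
    · rw [mem_inter, PosRoot.mem_hook, PosRoot.mem_hook]
      refine ⟨Or.inr ⟨rfl, ?_⟩, Or.inr ⟨h, ?_⟩⟩
      · change (α.row : ℕ) ≤ α.col - 1
        omega
      · change (β.row : ℕ) ≤ α.col - 1
        omega
    · change (α.col : ℕ) - 2 < α.col
      omega
    · rw [mem_inter, PosRoot.mem_hook, PosRoot.mem_hook]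
      refine ⟨Or.inr ⟨rfl, ?_⟩, Or.inr ⟨h, ?_⟩⟩
      · change (α.row : ℕ) ≤ α.col - 2
        omega
      · change (β.row : ℕ) ≤ α.col - 2
        omega
    · have : (α.col : ℕ) - 1 = α.col - 2 :=
        congrArg (fun p : PosRoot n => ((PosRoot.row p : Fin n) : ℕ)) e
      omega

/-- The possible relative positions of two hooks. -/
lemma hook_cases (hα : (α.row : ℕ) + 1 < α.col) (hβ : (β.row : ℕ) + 1 < β.col) :
    ((α.row = β.row ∨ α.col = β.col) ∧ 1 < (α.hook ∩ β.hook).card) ∨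
    ((Below α β ∨ Below β α) ∧ (α.hook ∩ β.hook).card = 0) ∨
    ((Crossing α β ∨ Crossing β α) ∧ (α.hook ∩ β.hook).card = 1) := by
  by_cases h : α.row = β.row ∨ α.col = β.col
  · exact Or.inl ⟨h, one_lt_card_hook_inter hα hβ h⟩
  right
  rw [not_or] at h
  have key : ∀ {α β : PosRoot n}, α.row < β.row → α.col ≠ β.col → Below α β ∨ Crossing α β := by
    intro α β h1 h2
    by_cases h3 : Below α β
    · exact Or.inl h3
    · simp only [Below, not_and, not_or, not_lt, not_le] at h3
      exact Or.inr ⟨h1, (h3 h1).2, lt_of_le_of_ne (h3 h1).1 h2⟩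
  rcases lt_or_gt_of_ne h.1 with h1 | h1
  · rcases key h1 h.2 with h2 | h2
    · exact Or.inl ⟨Or.inl h2, by rw [h2.hook_inter, card_empty]⟩
    · exact Or.inr ⟨Or.inl h2, h2.card_hook_inter⟩
  · rcases key h1 (Ne.symm h.2) with h2 | h2
    · exact Or.inl ⟨Or.inr h2, by rw [inter_comm, h2.hook_inter, card_empty]⟩
    · exact Or.inr ⟨Or.inr h2, by rw [inter_comm, h2.card_hook_inter]⟩

lemma isClosedRoots_subtri (a b : ℕ) : IsClosedRoots {p : PosRoot n | a ≤ p.i ∧ p.j ≤ b} := by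
  rintro r s t h1 h2 ⟨hrs, -⟩ ⟨-, hst⟩
  exact ⟨hrs, hst⟩

/-- It suffices to test the root element at `γ` itself. The truncated subtraction in `α.j - 1` is
harmless since the column of a root is positive. -/
lemma subtri_le_iff [Finite F] (α γ : PosRoot n) :
    subtri F n γ.i γ.j ≤ subtri F n (α.i + 1) (α.j - 1) ↔ α.row < γ.row ∧ γ.col < α.col := by
  have hα : (α.row : ℕ) < α.col := α.row_lt_col
  constructor
  · intro h
    have h1 : rootElt γ (1 : F) ∈ subtri F n γ.i γ.j :=
      Subgroup.mem_iSup_of_mem γ (Subgroup.mem_iSup_of_mem ⟨le_rfl, le_rfl⟩ (rootElt_mem_X _ _))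
    have h2 := h h1
    rw [subtri, mem_gen (isClosedRoots_subtri _ _)] at h2
    have h3 : γ ∈ {p : PosRoot n | α.i + 1 ≤ p.i ∧ p.j ≤ α.j - 1} := by
      by_contra h3
      have := h2 γ h3
      rw [coord_rootElt, Pi.single_eq_same] at this
      exact one_ne_zero this
    obtain ⟨h4, h5⟩ := h3
    simp only [PosRoot.i, PosRoot.j] at h4 h5
    omega
  · rintro ⟨h1, h2⟩
    refine iSup₂_le fun p hp => le_iSup₂_of_le p ?_ le_rfl
    obtain ⟨h3, h4⟩ := hp
    change α.i + 1 ≤ p.i ∧ p.j ≤ α.j - 1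
    simp only [PosRoot.i, PosRoot.j] at *
    omega

end Hooks

/-! ### Decomposition of products of elementary characters -/

section Decomposition

open Classical Matrix Finset

variable {n : ℕ} {F : Type*} [Field F] [Fintype F] {ψ : AddChar F ℂ} {α β : PosRoot n}

lemma sum_arm {M : Type*} [AddCommMonoid M] (α : PosRoot n) (f : Fin n → Fin n → M) :
    ∑ γ ∈ α.arm, f γ.row γ.col = ∑ t ∈ Ioo α.row α.col, f α.row t := by
  refine sum_bij (fun γ _ => γ.col) (fun γ hγ => ?_) (fun γ hγ γ' hγ' h => ?_) (fun t ht => ?_)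
    fun γ hγ => ?_
  · rw [PosRoot.mem_arm] at hγ
    exact mem_Ioo.2 ⟨hγ.1 ▸ γ.row_lt_col, hγ.2⟩
  · rw [PosRoot.mem_arm] at hγ hγ'
    exact PosRoot.ext_iff'.2 ⟨hγ.1.trans hγ'.1.symm, h⟩
  · rw [mem_Ioo] at ht
    exact ⟨⟨(α.row, t), ht.1⟩, PosRoot.mem_arm.2 ⟨rfl, ht.2⟩, rfl⟩
  · rw [(PosRoot.mem_arm.1 hγ).1]

lemma sum_leg {M : Type*} [AddCommMonoid M] (α : PosRoot n) (f : Fin n → Fin n → M) :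
    ∑ γ ∈ α.leg, f γ.row γ.col = ∑ r ∈ Ioo α.row α.col, f r α.col := by
  refine sum_bij (fun γ _ => γ.row) (fun γ hγ => ?_) (fun γ hγ γ' hγ' h => ?_) (fun t ht => ?_)
    fun γ hγ => ?_
  · rw [PosRoot.mem_leg] at hγ
    exact mem_Ioo.2 ⟨hγ.2, hγ.1 ▸ γ.row_lt_col⟩
  · rw [PosRoot.mem_leg] at hγ hγ'
    exact PosRoot.ext_iff'.2 ⟨h, hγ.1.trans hγ'.1.symm⟩
  · rw [mem_Ioo] at ht
    exact ⟨⟨(t, α.col), ht.2⟩, PosRoot.mem_leg.2 ⟨rfl, ht.1⟩, rfl⟩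
  · rw [(PosRoot.mem_leg.1 hγ).1]

lemma sum_inner {M : Type*} [AddCommMonoid M] (α : PosRoot n) (f : Fin n → Fin n → M) :
    ∑ γ ∈ univ.filter (fun γ : PosRoot n => α.row < γ.row ∧ γ.col < α.col), f γ.row γ.col =
      ∑ r ∈ Ioo α.row α.col, ∑ t ∈ Ioo r α.col, f r t := by
  rw [sum_sigma']
  refine sum_bij (fun γ _ => ⟨γ.row, γ.col⟩) (fun γ hγ => ?_) (fun γ hγ γ' hγ' h => ?_)
    (fun t ht => ?_) fun γ hγ => rfl
  · rw [mem_filter] at hγ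
    rw [mem_sigma, mem_Ioo, mem_Ioo]
    exact ⟨⟨hγ.2.1, γ.row_lt_col.trans hγ.2.2⟩, γ.row_lt_col, hγ.2.2⟩
  · rw [Sigma.mk.injEq] at h
    exact PosRoot.ext_iff'.2 ⟨h.1, eq_of_heq h.2⟩
  · rw [mem_sigma, mem_Ioo, mem_Ioo] at ht
    exact ⟨⟨(t.1, t.2), ht.2.1⟩, mem_filter.2 ⟨mem_univ _, ht.1.1, ht.2.2⟩, rfl⟩

omit [Fintype F] in
-- The degree is `q` to the number of indices strictly between row and column, so adjacent indices
-- give degree `1`.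
lemma nonlinear_iff [Finite F] {μ : BaseChar F α} (h : elem μ 1 ≠ 1) :
    (α.row : ℕ) + 1 < α.col := by
  have := Fintype.ofFinite F
  have hψ := (AddChar.FiniteField.primitiveChar_to_Complex_isPrimitive F)
  rw [elem_eq_elemFun hψ, elemFun_one, card_between] at h
  by_contra h1
  have : (α.col : ℕ) - α.row - 1 = 0 := by omega
  rw [this, pow_zero] at h
  exact h rfl

lemma elemFun_neg (α : PosRoot n) (c : F) : elemFun ψ α (-c) = star (elemFun ψ α c) := by
  ext g
  rw [Pi.star_apply, elemFun, elemFun, chi, chi, ← starRingEnd_apply, map_sum]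
  refine sum_congr rfl fun x _ => ?_
  rw [← AddChar.map_neg_eq_conj, neg_mul]

variable (hψ : ψ.IsPrimitive)
include hψ

lemma numFix_eq_arm (α : PosRoot n) (g : U n F) : numFix (nil g) α.row α.col =
    1 + ∑ γ ∈ α.arm, ∑ u : Fˣ, elemFun ψ γ u g := by
  rw [numFix_eq hψ (isStrict_nil g) α.row_lt_col]
  exact congrArg _ (sum_arm α fun a b => ∑ u : Fˣ, chi ψ (nil g) a b u).symm

/-- Reflect the expansion along the arm; `chi_flip` turns the reflected characters into those along
the leg. -/
lemma numFix_flip_eq_leg (α : PosRoot n) (g : U n F) :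
    numFix (flip (nil g)) α.col.rev α.row.rev =
      1 + ∑ γ ∈ α.leg, ∑ u : Fˣ, elemFun ψ γ u g := by
  rw [numFix_eq hψ (isStrict_nil g).flip (Fin.rev_lt_rev.2 α.row_lt_col)]
  refine congrArg _ (Eq.trans ?_ (sum_leg α fun a b => ∑ u : Fˣ, chi ψ (nil g) a b u).symm)
  refine sum_nbij' Fin.rev Fin.rev ?_ ?_ (fun _ _ => Fin.rev_rev _) (fun _ _ => Fin.rev_rev _) ?_
  · intro t ht
    rw [mem_Ioo] at ht ⊢
    exact ⟨by rw [← Fin.rev_lt_rev, Fin.rev_rev]; exact ht.2,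
      by rw [← Fin.rev_lt_rev, Fin.rev_rev]; exact ht.1⟩
  · intro t ht
    rw [mem_Ioo] at ht ⊢
    exact ⟨Fin.rev_lt_rev.2 ht.2, Fin.rev_lt_rev.2 ht.1⟩
  · intro t _
    refine sum_congr rfl fun u _ => ?_
    rw [← chi_flip hψ (nil g) t.rev α.col u.ne_zero, Fin.rev_rev]

omit hψ in
lemma elemFun_mul_of_mem_leg (h : α ∈ β.leg) (c d : Fˣ) (g : U n F) :
    elemFun ψ α c g * elemFun ψ β d g = numFix (nil g) α.row α.col * elemFun ψ β d g := by
  rw [PosRoot.mem_leg] at h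
  rw [elemFun, elemFun, ← h.1]
  exact chi_mul_chi_same_col (isStrict_nil g) h.2 α.row_lt_col _ d.ne_zero

/-- Reflection turns two roots in the same row into two roots in the same column. -/
lemma elemFun_mul_of_mem_arm (h : α ∈ β.arm) (c d : Fˣ) (g : U n F) :
    elemFun ψ α c g * elemFun ψ β d g =
      numFix (flip (nil g)) α.col.rev α.row.rev * elemFun ψ β d g := by
  rw [PosRoot.mem_arm] at h
  rw [elemFun, elemFun, ← h.1, ← chi_flip hψ (nil g) α.row α.col c.ne_zero,
    ← chi_flip hψ (nil g) α.row β.col d.ne_zero]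
  exact chi_mul_chi_same_col (isStrict_nil g).flip (Fin.rev_lt_rev.2 h.2)
    (Fin.rev_lt_rev.2 α.row_lt_col) _ d.ne_zero

/-- Each possible leading index `r` contributes `1` plus the elementary characters at the inner
roots in row `r`. The `j - i` ones add up to the constant `1 + (q - 1) (j - i)`, the multiplicity of
the elementary constituent. -/
lemma card_fixMid_eq (α : PosRoot n) (g : U n F) :
    ((fixMid (nil g) α.row α.col).card : ℂ) =
      1 + ((Fintype.card F : ℂ) - 1) * ((between α.row α.col).card +
        ∑ γ ∈ univ.filter (fun γ : PosRoot n => α.row < γ.row ∧ γ.col < α.col),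
          ∑ u : Fˣ, elemFun ψ γ u g) := by
  rw [card_fixMid (isStrict_nil g)]
  have h1 : ∀ r ∈ Ioo α.row α.col, numFix (nil g) r α.col =
      1 + ∑ t ∈ Ioo r α.col, ∑ u : Fˣ, chi ψ (nil g) r t u := fun r hr =>
    numFix_eq hψ (isStrict_nil g) (mem_Ioo.1 hr).2
  have h2 : (Ioo α.row α.col).card = (between α.row α.col).card := by
    rw [Fin.card_Ioo, card_between]
  rw [sum_congr rfl h1, sum_add_distrib, sum_const, nsmul_eq_mul, mul_one, h2]
  congr 3
  exact (sum_inner α fun a b => ∑ u : Fˣ, chi ψ (nil g) a b u).symm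

lemma finsum_baseChar {M : Type*} [AddCommMonoid M] (β : PosRoot n) (f : (U n F → ℂ) → M) :
    ∑ᶠ μ : BaseChar F β, f (elem μ) = ∑ u : Fˣ, f (elemFun ψ β u) := by
  have : Fintype (BaseChar F β) := Fintype.ofFinite _
  rw [finsum_eq_sum_of_fintype]
  exact Fintype.sum_equiv (baseCharEquiv hψ β) _ _ fun μ => by rw [elem_eq_elemFun hψ]

/-- Decomposition of a sum of an elementary character at `α` and its products with elementary
characters at roots below `α`. -/
lemma decomposesInto_of_below {P : PosRoot n → Prop} (hP : ∀ γ, P γ → Below α γ) (c : Fˣ)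
    {χ : U n F → ℂ} {k₀ k₁ : ℕ}
    (hχ : ∀ g, χ g = k₀ * elemFun ψ α c g + k₁ * ∑ γ ∈ univ.filter P, ∑ u : Fˣ,
      elemFun ψ α c g * elemFun ψ γ u g)
    (m : Option (Σ γ : {γ : PosRoot n // P γ}, BaseChar F γ.1) → ℕ)
    (φ : Option (Σ γ : {γ : PosRoot n // P γ}, BaseChar F γ.1) → U n F → ℂ)
    (hm₀ : m none = k₀) (hm₁ : ∀ s, m (some s) = k₁) (hφ₀ : φ none = elemFun ψ α c)
    (hφ₁ : ∀ s, φ (some s) = elemFun ψ α c * elem s.2) : DecomposesInto χ m φ := by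
  refine ⟨?_, ?_, ?_⟩
  · rintro (_ | s)
    · rw [hφ₀]
      exact isIrr_elemFun hψ α c
    · rw [hφ₁, elem_eq_elemFun hψ]
      exact isIrr_mul_elemFun hψ (hP _ s.1.2) c _
  · rintro (_ | ⟨⟨γ, hγ⟩, μ⟩) (_ | ⟨⟨γ', hγ'⟩, μ'⟩) h
    · rfl
    · rw [hφ₀, hφ₁, elem_eq_elemFun hψ] at h
      exact absurd h (elemFun_ne_mul hψ (hP _ hγ') c _)
    · rw [hφ₀, hφ₁, elem_eq_elemFun hψ] at h
      exact absurd h.symm (elemFun_ne_mul hψ (hP _ hγ) c _)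
    · rw [hφ₁, hφ₁, elem_eq_elemFun hψ, elem_eq_elemFun hψ] at h
      obtain ⟨h1, h2⟩ := eq_of_mul_elemFun_eq hψ (hP _ hγ) (hP _ hγ') c _ _ h
      change γ = γ' at h1
      subst h1
      have h3 : μ = μ' := (baseCharEquiv hψ γ).injective h2
      rw [h3]
  · have : ∀ γ : PosRoot n, Fintype (BaseChar F γ) := fun γ => Fintype.ofFinite _
    ext g
    rw [finsum_eq_sum_of_fintype, Fintype.sum_option, Fintype.sum_sigma, Pi.add_apply, hm₀, hφ₀, hχ]
    simp only [hm₁, hφ₁, Finset.sum_apply, Pi.smul_apply, Pi.mul_apply]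
    simp only [nsmul_eq_mul, mul_sum]
    refine congrArg _ ?_
    rw [← sum_subtype (p := P) (univ.filter P) (by simp)
      (f := fun γ => ∑ μ : BaseChar F γ, (k₁ : ℂ) * (elemFun ψ α c g * elem μ g))]
    refine sum_congr rfl fun γ _ => ?_
    exact (Fintype.sum_equiv (baseCharEquiv hψ γ) _ _ fun μ => by rw [elem_eq_elemFun hψ]).symm

end Decomposition

/-! ### The individual cases of the product of two elementary characters. -/

section CaseAnalysis

open Classical Matrix Finset

variable {n : ℕ} {α β : PosRoot n}

lemma filter_mem_univ {ι : Type*} [Fintype ι] (s : Finset ι) [DecidablePred (· ∈ s)] :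
    univ.filter (· ∈ s) = s := by
  ext
  simp

lemma below_of_mem_leg (h : α ∈ β.leg) {γ : PosRoot n} (hγ : γ ∈ α.arm) : Below β γ := by
  rw [PosRoot.mem_leg] at h
  rw [PosRoot.mem_arm] at hγ
  exact ⟨hγ.1 ▸ h.2, Or.inl (h.1 ▸ hγ.2)⟩

lemma below_of_mem_arm (h : α ∈ β.arm) {γ : PosRoot n} (hγ : γ ∈ α.leg) : Below β γ := by
  rw [PosRoot.mem_arm] at h
  rw [PosRoot.mem_leg] at hγ
  exact ⟨h.1 ▸ hγ.2, Or.inl (hγ.1 ▸ h.2)⟩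

variable {F : Type*} [Field F] [Fintype F] {ψ : AddChar F ℂ}

lemma card_hookGroup_inf_eq_one_iff (α β : PosRoot n) :
    Nat.card ↥(hookGroup F α ⊓ hookGroup F β) = 1 ↔ (α.hook ∩ β.hook).card = 0 := by
  rw [card_hookGroup_inf, Nat.pow_eq_one, or_iff_right Finite.one_lt_card.ne']

lemma card_hookGroup_inf_eq_card_iff (α β : PosRoot n) :
    Nat.card ↥(hookGroup F α ⊓ hookGroup F β) = Nat.card F ↔ (α.hook ∩ β.hook).card = 1 := by
  rw [card_hookGroup_inf]
  nth_rw 2 [← pow_one (Nat.card F)]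
  exact (Nat.pow_right_injective (Finite.one_lt_card (α := F))).eq_iff

variable (hψ : ψ.IsPrimitive)
include hψ

lemma Crossing.exists_decomposesInto (h : Crossing α β) (c d : Fˣ) :
    ∃ χ : Fin (Nat.card F) → U n F → ℂ,
      DecomposesInto (elemFun ψ α c * elemFun ψ β d) (fun _ => 1) χ ∧
      ∀ t, χ t 1 = (Nat.card F : ℂ) ^ ((α.j - α.i) + (β.j - β.i) - 1) := by
  let e := Finite.equivFin F
  obtain ⟨h1, h2⟩ := h.decomposes hψ c d
  refine ⟨fun t => ind (h.hom ψ c d (e.symm t)), ⟨fun t => h1 _, fun t t' htt => ?_, ?_⟩, fun t => ?_⟩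
  · exact e.symm.injective (h2 htt)
  · rw [finsum_eq_sum_of_fintype, ← h.sum_ind hψ c d]
    exact Fintype.sum_equiv e _ _ fun u => by simp only [Equiv.symm_apply_apply, one_smul]
  · refine (h.degree hψ c d _).trans ?_
    rw [card_between, card_between, Nat.card_eq_fintype_card, Nat.sub_sub, Nat.sub_sub]
    rfl

omit [Fintype F] hψ in
lemma HasCoeff.mul {μ ν : baseGroup F α →* ℂˣ} {c d : F}
    (hμ : HasCoeff ψ α μ c) (hν : HasCoeff ψ α ν d) : HasCoeff ψ α (μ * ν) (c + d) := by
  intro v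
  rw [MonoidHom.mul_apply, Units.val_mul, hμ, hν, add_mul, AddChar.map_add_eq_mul]

lemma elem_mul_elem_eq (lam₁ lam₂ : BaseChar F α) (h : elem lam₁ = star (elem lam₂)) :
    elem lam₁ * elem lam₂ = 1 + (∑ β₁ ∈ α.arm, ∑ᶠ μ₁ : BaseChar F β₁, elem μ₁)
      + (∑ β₂ ∈ α.leg, ∑ᶠ μ₂ : BaseChar F β₂, elem μ₂)
      + ∑ β₁ ∈ α.arm, ∑ β₂ ∈ α.leg,
          ∑ᶠ μ₁ : BaseChar F β₁, ∑ᶠ μ₂ : BaseChar F β₂, elem μ₁ * elem μ₂ := by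
  have e1 : ∀ β : PosRoot n, ∑ᶠ μ : BaseChar F β, elem μ = ∑ u : Fˣ, elemFun ψ β u := fun β =>
    finsum_baseChar hψ β id
  have e2 : ∀ β γ : PosRoot n, ∑ᶠ μ₁ : BaseChar F β, ∑ᶠ μ₂ : BaseChar F γ, elem μ₁ * elem μ₂ =
      (∑ u : Fˣ, elemFun ψ β u) * ∑ u : Fˣ, elemFun ψ γ u := fun β γ => by
    rw [finsum_baseChar hψ β fun f => ∑ᶠ μ₂ : BaseChar F γ, f * elem μ₂, sum_mul_sum]
    exact sum_congr rfl fun u _ => finsum_baseChar hψ γ fun f => elemFun ψ β u * f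
  -- Conjugation negates the coefficient, so the product splits into the counts of fixed rows and of
  -- fixed columns, which expand along the arm and the leg.
  have e3 : elem lam₁ * elem lam₂ = (1 + ∑ β₁ ∈ α.arm, ∑ u : Fˣ, elemFun ψ β₁ u) *
      (1 + ∑ β₂ ∈ α.leg, ∑ u : Fˣ, elemFun ψ β₂ u) := by
    rw [h, elem_eq_elemFun hψ, ← elemFun_neg]
    ext g
    simp only [Pi.mul_apply, Pi.add_apply, Finset.sum_apply, Pi.one_apply]
    rw [← numFix_eq_arm hψ, ← numFix_flip_eq_leg hψ]
    exact chi_mul_chi_neg hψ (isStrict_nil g) _ _ (Units.ne_zero _)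
  simp only [e1, e2]
  rw [e3, ← sum_mul_sum]
  ring

lemma elem_mul_elem_decomposesInto (hα : (α.row : ℕ) + 1 < α.col) (lam₁ lam₂ : BaseChar F α)
    (h : elem lam₁ ≠ star (elem lam₂))
    (m : Option (Σ γ : {γ : PosRoot n // subtri F n γ.i γ.j ≤ subtri F n (α.i + 1) (α.j - 1)},
      BaseChar F γ.1) → ℕ)
    (φ : Option (Σ γ : {γ : PosRoot n // subtri F n γ.i γ.j ≤ subtri F n (α.i + 1) (α.j - 1)},
      BaseChar F γ.1) → U n F → ℂ)
    (hm₀ : m none = Nat.card F + (α.j - α.i - 1) * (Nat.card F - 1))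
    (hm₁ : ∀ s, m (some s) = Nat.card F - 1) (hφ₀ : φ none = ind (lam₁.1 * lam₂.1))
    (hφ₁ : ∀ s, φ (some s) = ind (lam₁.1 * lam₂.1) * elem s.2) :
    DecomposesInto (elem lam₁ * elem lam₂) m φ := by
  set c := baseCharEquiv hψ α lam₁ with hc
  set d := baseCharEquiv hψ α lam₂ with hd
  -- Opposite coefficients would make the two elementary characters complex conjugate.
  have hcd : (c : F) + d ≠ 0 := by
    intro h0
    refine h ?_
    rw [elem_eq_elemFun hψ, elem_eq_elemFun hψ, ← elemFun_neg, ← hc, ← hd, eq_neg_of_add_eq_zero_left h0]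
  have hind : ind (lam₁.1 * lam₂.1) = elemFun ψ α (Units.mk0 _ hcd : Fˣ) := funext fun g =>
    ind_eq_chi ((hasCoeff_baseCharEquiv hψ lam₁).mul (hasCoeff_baseCharEquiv hψ lam₂)) g
  rw [hind] at hφ₀
  simp only [hind] at hφ₁
  refine decomposesInto_of_below hψ (fun γ hγ => ?_) _ (fun g => ?_) m φ hm₀ hm₁ hφ₀ hφ₁
  · rw [subtri_le_iff] at hγ
    exact ⟨hγ.1, Or.inl hγ.2⟩
  · have hK := chi_mul_chi_add (ψ := ψ) (isStrict_nil g) α.row α.col hcd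
    rw [card_fixMid_eq hψ] at hK
    have hq : 1 ≤ Nat.card F := Nat.card_pos
    -- Nonlinearity makes `j - i` positive; splitting off one turns `1 + (q - 1) (j - i)` into `q +
    -- (j - i - 1) (q - 1)`.
    have hb : (between α.row α.col).card = (α.j - α.i - 1) + 1 := by
      rw [card_between]
      simp only [PosRoot.i, PosRoot.j]
      omega
    rw [Pi.mul_apply, elem_eq_elemFun hψ, elem_eq_elemFun hψ]
    refine hK.trans ?_
    simp only [subtri_le_iff, ← mul_sum]
    rw [hb, Nat.cast_succ, Nat.cast_add, Nat.cast_mul, Nat.cast_sub hq, Nat.card_eq_fintype_card,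
      Nat.cast_one]
    change _ * elemFun ψ α (c + d) g = _ * elemFun ψ α (c + d) g + _ * (elemFun ψ α (c + d) g * _)
    ring

lemma elem_mul_elem_decomposesInto_of_leg (h : α ∈ β.leg) (lam₁ : BaseChar F α)
    (lam₂ : BaseChar F β) (m : Option (Σ γ : {γ : PosRoot n // γ ∈ α.arm}, BaseChar F γ.1) → ℕ)
    (φ : Option (Σ γ : {γ : PosRoot n // γ ∈ α.arm}, BaseChar F γ.1) → U n F → ℂ)
    (hm : ∀ s, m s = 1) (hφ₀ : φ none = elem lam₂) (hφ₁ : ∀ s, φ (some s) = elem lam₂ * elem s.2) :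
    DecomposesInto (elem lam₁ * elem lam₂) m φ := by
  simp only [elem_eq_elemFun hψ lam₂] at hφ₀ hφ₁
  refine decomposesInto_of_below hψ (fun γ hγ => below_of_mem_leg h hγ) _ (fun g => ?_) m φ
    (hm none) (fun s => hm _) hφ₀ hφ₁
  rw [Pi.mul_apply, elem_eq_elemFun hψ, elem_eq_elemFun hψ, elemFun_mul_of_mem_leg h,
    numFix_eq_arm hψ, filter_mem_univ]
  simp only [← mul_sum, Nat.cast_one]
  ring

lemma elem_mul_elem_decomposesInto_of_arm (h : α ∈ β.arm) (lam₁ : BaseChar F α)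
    (lam₂ : BaseChar F β) (m : Option (Σ γ : {γ : PosRoot n // γ ∈ α.leg}, BaseChar F γ.1) → ℕ)
    (φ : Option (Σ γ : {γ : PosRoot n // γ ∈ α.leg}, BaseChar F γ.1) → U n F → ℂ)
    (hm : ∀ s, m s = 1) (hφ₀ : φ none = elem lam₂) (hφ₁ : ∀ s, φ (some s) = elem lam₂ * elem s.2) :
    DecomposesInto (elem lam₁ * elem lam₂) m φ := by
  simp only [elem_eq_elemFun hψ lam₂] at hφ₀ hφ₁
  refine decomposesInto_of_below hψ (fun γ hγ => below_of_mem_arm h hγ) _ (fun g => ?_) m φ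
    (hm none) (fun s => hm _) hφ₀ hφ₁
  rw [Pi.mul_apply, elem_eq_elemFun hψ, elem_eq_elemFun hψ, elemFun_mul_of_mem_arm hψ h,
    numFix_flip_eq_leg hψ, filter_mem_univ]
  simp only [← mul_sum, Nat.cast_one]
  ring

end CaseAnalysis

end UTri

end

open UTri in
theorem lemma3p4 (n : ℕ) (F : Type*) [Field F] [Finite F] :
    -- one of the five cases applies to two nonlinear elementary characters, up to interchanging them
    (∀ (α β : PosRoot n) (lam₁ : BaseChar F α) (lam₂ : BaseChar F β),
      elem lam₁ 1 ≠ 1 → elem lam₂ 1 ≠ 1 →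
      Nat.card ↥(hookGroup F α ⊓ hookGroup F β) = 1 ∨
      Nat.card ↥(hookGroup F α ⊓ hookGroup F β) = Nat.card F ∨
      (α ∈ β.leg ∨ α ∈ β.arm ∨ β ∈ α.leg ∨ β ∈ α.arm) ∨
      α = β) ∧
    -- (i)
    (∀ (α β : PosRoot n) (lam₁ : BaseChar F α) (lam₂ : BaseChar F β),
      elem lam₁ 1 ≠ 1 → elem lam₂ 1 ≠ 1 →
      Nat.card ↥(hookGroup F α ⊓ hookGroup F β) = 1 →
      IsIrr (elem lam₁ * elem lam₂)) ∧
    -- (ii)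
    (∀ (α β : PosRoot n) (lam₁ : BaseChar F α) (lam₂ : BaseChar F β),
      elem lam₁ 1 ≠ 1 → elem lam₂ 1 ≠ 1 →
      Nat.card ↥(hookGroup F α ⊓ hookGroup F β) = Nat.card F →
      ∃ χ : Fin (Nat.card F) → U n F → ℂ,
        DecomposesInto (elem lam₁ * elem lam₂) (fun _ => 1) χ ∧
        ∀ t, χ t 1 = (Nat.card F : ℂ) ^ ((α.j - α.i) + (β.j - β.i) - 1)) ∧
    -- (iii), leg
    (∀ (α β : PosRoot n) (lam₁ : BaseChar F α) (lam₂ : BaseChar F β),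
      elem lam₁ 1 ≠ 1 → elem lam₂ 1 ≠ 1 →
      α ∈ β.leg →
      DecomposesInto (ι := Option (Σ γ : {γ : PosRoot n // γ ∈ α.arm}, BaseChar F γ.1))
        (elem lam₁ * elem lam₂) (fun _ => 1)
        (fun | none => elem lam₂
             | some s => elem lam₂ * elem s.2)) ∧
    -- (iii), arm
    (∀ (α β : PosRoot n) (lam₁ : BaseChar F α) (lam₂ : BaseChar F β),
      elem lam₁ 1 ≠ 1 → elem lam₂ 1 ≠ 1 →
      α ∈ β.arm →
      DecomposesInto (ι := Option (Σ γ : {γ : PosRoot n // γ ∈ α.leg}, BaseChar F γ.1))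
        (elem lam₁ * elem lam₂) (fun _ => 1)
        (fun | none => elem lam₂
             | some s => elem lam₂ * elem s.2)) ∧
    -- (iv)
    (∀ (α : PosRoot n) (lam₁ lam₂ : BaseChar F α),
      elem lam₁ 1 ≠ 1 → elem lam₂ 1 ≠ 1 →
      elem lam₁ ≠ star (elem lam₂) →
      DecomposesInto
        (ι := Option (Σ γ : {γ : PosRoot n // subtri F n γ.i γ.j ≤ subtri F n (α.i + 1) (α.j - 1)},
          BaseChar F γ.1))
        (elem lam₁ * elem lam₂)
        (fun | none => Nat.card F + (α.j - α.i - 1) * (Nat.card F - 1)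
             | some _ => Nat.card F - 1)
        (fun | none => ind (lam₁.1 * lam₂.1)
             | some s => ind (lam₁.1 * lam₂.1) * elem s.2)) ∧
    -- (v)
    (∀ (α : PosRoot n) (lam₁ lam₂ : BaseChar F α),
      elem lam₁ 1 ≠ 1 → elem lam₂ 1 ≠ 1 →
      elem lam₁ = star (elem lam₂) →
      elem lam₁ * elem lam₂ =
        1 + (∑ β₁ ∈ α.arm, ∑ᶠ μ₁ : BaseChar F β₁, elem μ₁)
          + (∑ β₂ ∈ α.leg, ∑ᶠ μ₂ : BaseChar F β₂, elem μ₂)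
          + ∑ β₁ ∈ α.arm, ∑ β₂ ∈ α.leg,
              ∑ᶠ μ₁ : BaseChar F β₁, ∑ᶠ μ₂ : BaseChar F β₂, elem μ₁ * elem μ₂) := by
  have := Fintype.ofFinite F
  have hψ := AddChar.FiniteField.primitiveChar_to_Complex_isPrimitive F
  refine ⟨?_, ?_, ?_, ?_, ?_, ?_, ?_⟩
  · intro α β lam₁ lam₂ h₁ h₂
    rw [card_hookGroup_inf_eq_one_iff, card_hookGroup_inf_eq_card_iff]
    rcases hook_cases (nonlinear_iff h₁) (nonlinear_iff h₂) with ⟨h, -⟩ | ⟨-, h⟩ | ⟨-, h⟩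
    · right; right
      simp only [PosRoot.mem_leg, PosRoot.mem_arm, PosRoot.ext_iff']
      omega
    · exact Or.inl h
    · exact Or.inr (Or.inl h)
  · intro α β lam₁ lam₂ h₁ h₂ h
    rw [card_hookGroup_inf_eq_one_iff] at h
    rw [elem_eq_elemFun hψ, elem_eq_elemFun hψ]
    rcases hook_cases (nonlinear_iff h₁) (nonlinear_iff h₂) with ⟨-, h'⟩ | ⟨h', -⟩ | ⟨-, h'⟩
    · omega
    · rcases h' with h' | h'
      · exact isIrr_mul_elemFun hψ h' _ _
      · rw [mul_comm]
        exact isIrr_mul_elemFun hψ h' _ _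
    · omega
  · intro α β lam₁ lam₂ h₁ h₂ h
    rw [card_hookGroup_inf_eq_card_iff] at h
    rw [elem_eq_elemFun hψ, elem_eq_elemFun hψ]
    rcases hook_cases (nonlinear_iff h₁) (nonlinear_iff h₂) with ⟨-, h'⟩ | ⟨-, h'⟩ | ⟨h', -⟩
    · omega
    · omega
    · rcases h' with h' | h'
      · exact h'.exists_decomposesInto hψ _ _
      · rw [mul_comm, add_comm (α.j - α.i)]
        exact h'.exists_decomposesInto hψ _ _
  · intro α β lam₁ lam₂ _ _ h
    exact elem_mul_elem_decomposesInto_of_leg hψ h lam₁ lam₂ _ _ (fun _ => rfl) rfl fun _ => rfl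
  · intro α β lam₁ lam₂ _ _ h
    exact elem_mul_elem_decomposesInto_of_arm hψ h lam₁ lam₂ _ _ (fun _ => rfl) rfl fun _ => rfl
  · intro α lam₁ lam₂ h₁ _ h
    exact elem_mul_elem_decomposesInto hψ (nonlinear_iff h₁) lam₁ lam₂ h _ _ rfl (fun _ => rfl) rfl
      fun _ => rfl
  · intro α lam₁ lam₂ _ _ h
    exact elem_mul_elem_eq hψ lam₁ lam₂ h
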